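/- Let $k$ be a field. All quivers are finite (finitely many vertices and arrows), paths are composed from left to right, and $s(\cdot)$, $e(\cdot)$ denote the start and the end of an arrow or path. For a quiver $Q$ let $kQ$ be its path algebra and $J$ the ideal of $kQ$ generated by the arrows; an ideal $K$ of $kQ$ is admissible if $J^m\subseteq K\subseteq J^2$ for some $m\ge 2$. A relation over $Q$ is a $k$-linear combination of paths of length at least $2$, all with the same start and all with the same end. Let $\Gamma$ be an acyclic quiver with vertices $1,\dots,n$. For each $i$ let $\Sigma_i$ be a quiver, $\Omega_i$ an admissible ideal of $k\Sigma_i$, and $A_i=k\Sigma_i/\Omega_i$; put $\mathcal A=(A_1,\dots,A_n)$. Let $I$ be a set of relations over $\Gamma$ that generates an admissible ideal of $k\Gamma$. The generalized path algebra $k(\Gamma,\mathcal A)$ is the $k$-vector space spanned by the $\mathcal A$-paths $a_1\beta_1a_2\cdots a_r\beta_ra_{r+1}$ ($r\ge 0$, $\beta_1\cdots\beta_r$ a path of $\Gamma$, $a_j\in A_{s(\beta_j)}$ for $j\le r$, $a_{r+1}\in A_{e(\beta_r)}$; for $r=0$, an element of some $A_i$), modulo the subspace that makes $\mathcal A$-paths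 linear in each $a_j$, with the multiplication $(a_1\beta_1\cdots\beta_ra_{r+1})(b_1\gamma_1\cdots\gamma_tb_{t+1})=a_1\beta_1\cdots\beta_r(a_{r+1}b_1)\gamma_1\cdots\gamma_tb_{t+1}$ if the first $\mathcal A$-path ends at the vertex where the second starts, and $0$ otherwise. Let $\mathcal A(I)\subseteq k(\Gamma,\mathcal A)$ be the set of all elements $$\sum_i\lambda_i\,\beta_{i1}\overline{\gamma_{i1}}\beta_{i2}\cdots\overline{\gamma_{i(r_i-1)}}\beta_{ir_i},$$ where $\sum_i\lambda_i\beta_{i1}\cdots\beta_{ir_i}$ (a combination of distinct paths) is a relation in $I$, the $\gamma_{ij}$ are arbitrary paths in $\Sigma_{e(\beta_{ij})}$, and $\overline{\gamma_{ij}}$ is the class of $\gamma_{ij}$ in $A_{e(\beta_{ij})}$. The gbp-algebra $k(\Gamma,\mathcal A,I)$ is the quotient of $k(\Gamma,\mathcal A)$ by the ideal $(\mathcal A(I))$. Let $\Gamma[\Sigma_1,\dots,\Sigma_n]$ be the quiver whose vertices are the disjoint union of the vertices of the $\Sigma_i$ and whose arrows are the arrows of the $\Sigma_i$ together with, for every arrow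 $\alpha:i\to j$ of $\Gamma$ (so $i\neq j$), every vertex $x$ of $\Sigma_i$ and every vertex $y$ of $\Sigma_j$, one arrow $\alpha_{x,y}:x\to y$. Let $(\Omega_1,\dots,\Omega_n)$ be the ideal of $k\Gamma[\Sigma_1,\dots,\Sigma_n]$ generated by $\Omega_1,\dots,\Omega_n$. Let $R(I)$ be the set of all elements $$\sum_i\lambda_i\,(\beta_{i1})_{x,s(\gamma_{i1})}\,\gamma_{i1}\,(\beta_{i2})_{e(\gamma_{i1}),s(\gamma_{i2})}\,\gamma_{i2}\cdots\gamma_{i(r_i-1)}\,(\beta_{ir_i})_{e(\gamma_{i(r_i-1)}),y}$$ of $k\Gamma[\Sigma_1,\dots,\Sigma_n]$, where $\sum_i\lambda_i\beta_{i1}\cdots\beta_{ir_i}$ (a combination of distinct paths) is a relation in $I$ from $l$ to $l'$, $x$ is a vertex of $\Sigma_l$, $y$ is a vertex of $\Sigma_{l'}$, and the $\gamma_{ij}$ are arbitrary paths in $\Sigma_{e(\beta_{ij})}$. Let $L(I)$ be the ideal generated by $R(I)$. Then 1. $(\Omega_1,\dots,\Omega_n)+L(I)$ is an admissible ideal of $k\Gamma[\Sigma_1,\dots,\Sigma_n]$,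 and 2. there is an isomorphism of $k$-algebras $$\frac{k\Gamma[\Sigma_1,\dots,\Sigma_n]}{(\Omega_1,\dots,\Omega_n)+L(I)}\;\cong\;\frac{k(\Gamma,\mathcal A)}{(\mathcal A(I))}=k(\Gamma,\mathcal A,I).$$ -/

import Mathlib

/-!
Path algebras, generalized path algebras (Coelho-Liu), generalized bound path algebras,
the quiver `Γ[Σ₁, …, Σₙ]` and the relations on it induced by relations on `Γ`.

Paths are composed from left to right: `p * q` is "first `p`, then `q`".
-/

noncomputable section

namespace GBP

universe u v w u₁ v₁ u₂ v₂

/-! ### The algebra spanned by composable paths -/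

/-- A family of "paths" `P i j` from `i` to `j` with an associative, unital composition. -/
class PathSystem {V : Type u} (P : V → V → Type w) where
  /-- the neutral path at a vertex -/
  nil' : ∀ i, P i i
  /-- composition: first `p`, then `q` -/
  comp' : ∀ {i j l}, P i j → P j l → P i l
  nil_comp' : ∀ {i j} (p : P i j), comp' (nil' i) p = p
  comp_nil' : ∀ {i j} (p : P i j), comp' p (nil' j) = p
  assoc' : ∀ {i j l m} (p : P i j) (q : P j l) (r : P l m),
    comp' (comp' p q) r = comp' p (comp' q r)

/-- The `k`-vector space having as basis all paths (with arbitrary end points). -/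
def PathSpan (k : Type u₁) [Field k] {V : Type u} (P : V → V → Type w) :=
  (Σ i, Σ j, P i j) →₀ k

namespace PathSpan

variable {k : Type u₁} [Field k] {V : Type u} {P : V → V → Type w}

instance : AddCommGroup (PathSpan k P) := inferInstanceAs (AddCommGroup (_ →₀ k))
instance : Module k (PathSpan k P) := inferInstanceAs (Module k (_ →₀ k))

/-- A path, seen as a basis vector. -/
def of (k : Type u₁) [Field k] {V : Type u} {P : V → V → Type w} {i j : V} (p : P i j) :
    PathSpan k P :=
  Finsupp.single ⟨i, j, p⟩ 1

/-- The linear map given on basis vectors by a function on paths. -/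
def lift {X : Type*} [AddCommGroup X] [Module k X] (f : ∀ i j, P i j → X) :
    PathSpan k P →ₗ[k] X :=
  Finsupp.linearCombination k (fun p : (Σ i, Σ j, P i j) => f p.1 p.2.1 p.2.2)

@[simp] theorem lift_of {X : Type*} [AddCommGroup X] [Module k X] (f : ∀ i j, P i j → X)
    {i j : V} (p : P i j) : lift (k := k) f (of k p) = f i j p := by
  simp only [lift, of]
  exact (Finsupp.linearCombination_single k _ _).trans (one_smul k _)

theorem hom_ext {X : Type*} [AddCommGroup X] [Module k X] {f g : PathSpan k P →ₗ[k] X}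
    (h : ∀ i j (p : P i j), f (of k p) = g (of k p)) : f = g := by
  refine Finsupp.lhom_ext' fun p => LinearMap.ext_ring ?_
  exact h p.1 p.2.1 p.2.2

theorem induct {motive : PathSpan k P → Prop} (x : PathSpan k P)
    (hof : ∀ i j (p : P i j), motive (of k p)) (h0 : motive 0)
    (hadd : ∀ x y, motive x → motive y → motive (x + y))
    (hsmul : ∀ (c : k) x, motive x → motive (c • x)) : motive x := by
  refine Finsupp.induction_linear (motive := motive) x h0 hadd fun p c => ?_
  have := hsmul c _ (hof p.1 p.2.1 p.2.2)
  have e : (c • of k p.2.2 : PathSpan k P) = Finsupp.single p c := by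
    simp only [of]
    exact (Finsupp.smul_single c _ _).trans (by simp)
  rwa [e] at this

variable [PathSystem P]

open Classical in
/-- The product of two paths: their composition if the first ends where the second starts,
and zero otherwise. -/
def mulPath (k : Type u₁) [Field k] {V : Type u} {P : V → V → Type w} [PathSystem P]
    {i j j' l : V} (p : P i j) (q : P j' l) : PathSpan k P :=
  if h : j = j' then of k (PathSystem.comp' p (h.symm ▸ q : P j l)) else 0

/-- The bilinear extension of `mulPath`. -/
def mulLin : PathSpan k P →ₗ[k] PathSpan k P →ₗ[k] PathSpan k P :=
  lift fun _ _ p => lift fun _ _ q => mulPath k p q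

instance : Mul (PathSpan k P) := ⟨fun x y => mulLin x y⟩

theorem mul_def (x y : PathSpan k P) : x * y = mulLin x y := rfl

theorem of_mul_of {i j l : V} (p : P i j) (q : P j l) :
    of k p * of k q = of k (PathSystem.comp' p q) := by
  simp [mul_def, mulLin, mulPath]

theorem of_mul_of_ne {i j j' l : V} (h : j ≠ j') (p : P i j) (q : P j' l) :
    of k p * of k q = 0 := by
  simp [mul_def, mulLin, mulPath, h]

variable [Fintype V]

/-- The identity is the sum of the neutral paths. -/
instance : One (PathSpan k P) := ⟨∑ i : V, of k (PathSystem.nil' i : P i i)⟩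

theorem one_def : (1 : PathSpan k P) = ∑ i : V, of k (PathSystem.nil' i : P i i) := rfl

instance : Ring (PathSpan k P) where
  __ := (inferInstance : AddCommGroup (PathSpan k P))
  mul := (· * ·)
  one := 1
  left_distrib x y z := by simp only [mul_def, map_add]
  right_distrib x y z := by simp only [mul_def, map_add, LinearMap.add_apply]
  zero_mul x := by simp only [mul_def, map_zero, LinearMap.zero_apply]
  mul_zero x := by simp only [mul_def, map_zero]
  one_mul x := by
    have : mulLin (1 : PathSpan k P) = LinearMap.id := by
      refine hom_ext fun i j p => ?_
      have h : ∀ y : PathSpan k P, ∀ s : Finset V,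
          mulLin (∑ i ∈ s, of k (PathSystem.nil' i : P i i)) y
            = ∑ i ∈ s, of k (PathSystem.nil' i : P i i) * y := fun y s => by
        simp [map_sum, mul_def]
      rw [one_def, h, Finset.sum_eq_single i]
      · simp [of_mul_of, PathSystem.nil_comp']
      · intro b _ hb
        exact of_mul_of_ne hb _ _
      · simp
    change mulLin 1 x = x
    rw [this]; rfl
  mul_one x := by
    have : mulLin.flip (1 : PathSpan k P) = LinearMap.id := by
      refine hom_ext fun i j p => ?_
      have h : ∀ y : PathSpan k P, ∀ s : Finset V,
          mulLin.flip (∑ i ∈ s, of k (PathSystem.nil' i : P i i)) y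
            = ∑ i ∈ s, y * of k (PathSystem.nil' i : P i i) := fun y s => by
        simp [map_sum, mul_def]
      rw [one_def, h, Finset.sum_eq_single j]
      · simp [of_mul_of, PathSystem.comp_nil']
      · intro b _ hb
        exact of_mul_of_ne hb.symm _ _
      · simp
    change mulLin.flip 1 x = x
    rw [this]; rfl
  mul_assoc x y z := by
    have hz : ∀ a : PathSpan k P, (0 : PathSpan k P) * a = 0 := fun a => by
      simp only [mul_def, map_zero, LinearMap.zero_apply]
    have hz' : ∀ a : PathSpan k P, a * (0 : PathSpan k P) = 0 := fun a => by
      simp only [mul_def, map_zero]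
    induction x using induct with
    | h0 => rw [hz, hz, hz]
    | hadd x₁ x₂ h₁ h₂ =>
      simp only [mul_def, map_add, LinearMap.add_apply] at h₁ h₂ ⊢
      rw [h₁, h₂]
    | hsmul c x₁ h₁ =>
      simp only [mul_def, map_smul, LinearMap.smul_apply] at h₁ ⊢
      rw [h₁]
    | hof i j p =>
    induction y using induct with
    | h0 => rw [hz, hz', hz]
    | hadd x₁ x₂ h₁ h₂ =>
      simp only [mul_def, map_add, LinearMap.add_apply] at h₁ h₂ ⊢
      rw [h₁, h₂]
    | hsmul c x₁ h₁ =>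
      simp only [mul_def, map_smul, LinearMap.smul_apply] at h₁ ⊢
      rw [h₁]
    | hof i' j' q =>
    induction z using induct with
    | h0 => rw [hz', hz', hz']
    | hadd x₁ x₂ h₁ h₂ =>
      simp only [mul_def, map_add] at h₁ h₂ ⊢
      rw [h₁, h₂]
    | hsmul c x₁ h₁ =>
      simp only [mul_def, map_smul] at h₁ ⊢
      rw [h₁]
    | hof i'' j'' r =>
    by_cases e : j = i'
    · subst e
      by_cases e' : j' = i''
      · subst e'
        rw [of_mul_of, of_mul_of, of_mul_of, of_mul_of, PathSystem.assoc']
      · rw [of_mul_of, of_mul_of_ne e', of_mul_of_ne e', hz']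
    · rw [of_mul_of_ne e, hz]
      by_cases e' : j' = i''
      · subst e'
        rw [of_mul_of, of_mul_of_ne e]
      · rw [of_mul_of_ne e', hz']

instance : Algebra k (PathSpan k P) :=
  Algebra.ofModule
    (fun c x y => by simp only [mul_def, map_smul, LinearMap.smul_apply])
    (fun c x y => by simp only [mul_def, map_smul])

end PathSpan

open PathSpan

/-! ### Path algebras, admissible ideals, relations -/

instance {Q : Type u} [Quiver.{v} Q] : PathSystem (fun a b : Q => Quiver.Path a b) where
  nil' _ := Quiver.Path.nil
  comp' p q := p.comp q
  nil_comp' := Quiver.Path.nil_comp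
  comp_nil' := Quiver.Path.comp_nil
  assoc' := Quiver.Path.comp_assoc

/-- The path algebra `kQ` of a quiver `Q`. -/
abbrev PathAlgebra (k : Type u₁) [Field k] (Q : Type u) [Quiver.{v} Q] :=
  PathSpan k (fun a b : Q => Quiver.Path a b)

/-- A path of `Q` as an element of `kQ`. -/
abbrev ofPath (k : Type u₁) [Field k] {Q : Type u} [Quiver.{v} Q] {a b : Q}
    (p : Quiver.Path a b) : PathAlgebra k Q :=
  PathSpan.of (P := fun a b : Q => Quiver.Path a b) k p

/-- `Q` has no oriented cycles (of positive length). -/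
def IsAcyclic (Q : Type u) [Quiver.{v} Q] : Prop :=
  ∀ (a : Q) (p : Quiver.Path a a), p.length = 0

theorem IsAcyclic.ne {Q : Type u} [Quiver.{v} Q] (h : IsAcyclic Q) {a b : Q} (α : a ⟶ b) :
    a ≠ b := by
  rintro rfl
  simpa using h a α.toPath

/-- The ideal of `kQ` generated by all arrows. -/
def arrowIdeal (k : Type u₁) [Field k] (Q : Type u) [Quiver.{v} Q] [Fintype Q] :
    TwoSidedIdeal (PathAlgebra k Q) :=
  TwoSidedIdeal.span {x | ∃ (a b : Q) (α : a ⟶ b), x = ofPath k α.toPath}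

/-- An ideal `I` of `kQ` is admissible if `Jⁿ ⊆ I ⊆ J²` for some `n ≥ 2`,
where `J` is the ideal generated by the arrows. -/
def IsAdmissible {k : Type u₁} [Field k] {Q : Type u} [Quiver.{v} Q] [Fintype Q]
    (I : TwoSidedIdeal (PathAlgebra k Q)) : Prop :=
  ∃ n : ℕ, 2 ≤ n ∧ (arrowIdeal k Q).asIdeal ^ n ≤ I.asIdeal ∧
    I.asIdeal ≤ (arrowIdeal k Q).asIdeal ^ 2

/-- The linear combination `∑ λ_p p` of parallel paths, as an element of `kQ`. -/
def combination {k : Type u₁} [Field k] {Q : Type u} [Quiver.{v} Q] {a b : Q}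
    (ρ : Quiver.Path a b →₀ k) : PathAlgebra k Q :=
  ρ.sum fun p c => c • ofPath k p

/-- A relation over `Q`: a linear combination of paths of length at least two, all with the same
start and all with the same end. -/
def IsRelation {k : Type u₁} [Field k] {Q : Type u} [Quiver.{v} Q] (r : PathAlgebra k Q) : Prop :=
  ∃ (a b : Q) (ρ : Quiver.Path a b →₀ k), (∀ p ∈ ρ.support, 2 ≤ p.length) ∧ r = combination ρ

/-! ### Generalized path algebras -/

/-- An `𝒜`-path `a₁ β₁ a₂ … aₙ βₙ aₙ₊₁` over `Γ`. -/
inductive APath {V : Type u} [Quiver.{v} V] (A : V → Type w) (i : V) : V → Type (max u v w)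
  | nil : A i → APath A i i
  | cons : ∀ {j l : V}, APath A i j → (j ⟶ l) → A l → APath A i l

namespace APath

variable {V : Type u} [Quiver.{v} V] {A : V → Type w} [∀ i, Ring (A i)]

/-- Multiply the last entry of an `𝒜`-path by an element on the right. -/
def rmul {i : V} : ∀ {j : V}, APath A i j → A j → APath A i j
  | _, nil a, b => nil (a * b)
  | _, cons p β a, b => cons p β (a * b)

/-- The product of composable `𝒜`-paths,
`(a₁ β₁ … βₙ aₙ₊₁)(b₁ γ₁ … γₘ bₘ₊₁) = a₁ β₁ … βₙ (aₙ₊₁ b₁) γ₁ … γₘ bₘ₊₁`. -/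
def comp {i j : V} (p : APath A i j) : ∀ {l : V}, APath A j l → APath A i l
  | _, nil b => p.rmul b
  | _, cons q β b => cons (p.comp q) β b

theorem rmul_rmul {i j : V} (p : APath A i j) (a b : A j) :
    (p.rmul a).rmul b = p.rmul (a * b) := by
  cases p <;> simp [rmul, mul_assoc]

theorem comp_rmul {i j l : V} (p : APath A i j) (q : APath A j l) (a : A l) :
    p.comp (q.rmul a) = (p.comp q).rmul a := by
  cases q with
  | nil b => exact (rmul_rmul p b a).symm
  | cons q β b => rfl

theorem comp_assoc {i j l m : V} (p : APath A i j) (q : APath A j l) (r : APath A l m) :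
    (p.comp q).comp r = p.comp (q.comp r) := by
  induction r with
  | nil a => simp [comp, comp_rmul]
  | cons r β a ih => simp [comp, ih]

theorem nil_comp {i j : V} (p : APath A i j) : (nil (1 : A i)).comp p = p := by
  induction p with
  | nil a => simp [comp, rmul]
  | cons r β a ih => simp [comp, ih]

theorem comp_nil {i j : V} (p : APath A i j) : p.comp (nil (1 : A j)) = p := by
  cases p <;> simp [comp, rmul]

instance : PathSystem (APath A) where
  nil' _ := nil 1
  comp' p q := p.comp q
  nil_comp' := nil_comp
  comp_nil' := comp_nil
  assoc' := comp_assoc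

end APath

section GPA

variable (k : Type u₁) [Field k] {V : Type u} [Quiver.{v} V] (A : V → Type w)
  [∀ i, Ring (A i)] [∀ i, Algebra k (A i)]

/-- The elements expressing linearity of an `𝒜`-path in each of its entries. Here `p a q`, with
`p = a₁ β₁ … β_{j-1} a'` and `q = a'' β_j … aₙ₊₁`, is the `𝒜`-path
`a₁ β₁ … β_{j-1} (a' a a'') β_j … aₙ₊₁`; with `a' = a'' = 1` every `𝒜`-path with a chosen entry
`a` has this form. -/
def linearityRelations : Set (PathSpan k (APath A)) :=
  {x | ∃ (i j l : V) (p : APath A i j) (q : APath A j l) (a b : A j),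
      x = of k (p.comp ((APath.nil (a + b)).comp q))
        - (of k (p.comp ((APath.nil a).comp q)) + of k (p.comp ((APath.nil b).comp q)))} ∪
  {x | ∃ (i j l : V) (p : APath A i j) (q : APath A j l) (c : k) (a : A j),
      x = of k (p.comp ((APath.nil (c • a)).comp q)) - c • of k (p.comp ((APath.nil a).comp q))}

/-- The subspace `M` of `k[Γ, 𝒜]` spanned by the linearity relations. -/
def linearitySubmodule : Submodule k (PathSpan k (APath A)) :=
  Submodule.span k (linearityRelations k A)

variable {k A}

theorem of_comp_mul {k : Type u₁} [Field k] {V : Type u} [Quiver.{v} V] {A : V → Type w}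
    [∀ i, Ring (A i)] {i j l : V} (p : APath A i j) (q : APath A j l) :
    of k p * of k q = of k (p.comp q) :=
  of_mul_of p q

variable [Fintype V]

theorem mul_mem_linearitySubmodule_left (x y : PathSpan k (APath A))
    (hy : y ∈ linearitySubmodule k A) : x * y ∈ linearitySubmodule k A := by
  induction x using PathSpan.induct with
  | h0 => rw [zero_mul]; exact zero_mem _
  | hadd x₁ x₂ h₁ h₂ => rw [add_mul]; exact add_mem h₁ h₂
  | hsmul c x₁ h₁ => rw [smul_mul_assoc]; exact Submodule.smul_mem _ c h₁
  | hof i' j' r =>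
    induction hy using Submodule.span_induction with
    | zero => rw [mul_zero]; exact zero_mem _
    | add x y _ _ h₁ h₂ => rw [mul_add]; exact add_mem h₁ h₂
    | smul c x _ h => rw [mul_smul_comm]; exact Submodule.smul_mem _ c h
    | mem x h =>
      rcases h with ⟨i, j, l, p, q, a, b, rfl⟩ | ⟨i, j, l, p, q, c, a, rfl⟩
      · by_cases e : j' = i
        · subst e
          refine Submodule.subset_span (Or.inl ⟨i', j, l, r.comp p, q, a, b, ?_⟩)
          simp only [mul_sub, mul_add, of_comp_mul, APath.comp_assoc]
        · simp only [mul_sub, mul_add, of_mul_of_ne e, sub_zero, add_zero]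
          exact zero_mem _
      · by_cases e : j' = i
        · subst e
          refine Submodule.subset_span (Or.inr ⟨i', j, l, r.comp p, q, c, a, ?_⟩)
          simp only [mul_sub, mul_smul_comm, of_comp_mul, APath.comp_assoc]
        · simp only [mul_sub, mul_smul_comm, of_mul_of_ne e, sub_zero, smul_zero]
          exact zero_mem _

theorem mul_mem_linearitySubmodule_right (y x : PathSpan k (APath A))
    (hy : y ∈ linearitySubmodule k A) : y * x ∈ linearitySubmodule k A := by
  induction x using PathSpan.induct with
  | h0 => rw [mul_zero]; exact zero_mem _
  | hadd x₁ x₂ h₁ h₂ => rw [mul_add]; exact add_mem h₁ h₂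
  | hsmul c x₁ h₁ => rw [mul_smul_comm]; exact Submodule.smul_mem _ c h₁
  | hof i' j' r =>
    induction hy using Submodule.span_induction with
    | zero => rw [zero_mul]; exact zero_mem _
    | add x y _ _ h₁ h₂ => rw [add_mul]; exact add_mem h₁ h₂
    | smul c x _ h => rw [smul_mul_assoc]; exact Submodule.smul_mem _ c h
    | mem x h =>
      rcases h with ⟨i, j, l, p, q, a, b, rfl⟩ | ⟨i, j, l, p, q, c, a, rfl⟩
      · by_cases e : l = i'
        · subst e
          refine Submodule.subset_span (Or.inl ⟨i, j, j', p, q.comp r, a, b, ?_⟩)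
          simp only [sub_mul, add_mul, of_comp_mul, APath.comp_assoc]
        · simp only [sub_mul, add_mul, of_mul_of_ne e, sub_zero, add_zero]
          exact zero_mem _
      · by_cases e : l = i'
        · subst e
          refine Submodule.subset_span (Or.inr ⟨i, j, j', p, q.comp r, c, a, ?_⟩)
          simp only [sub_mul, smul_mul_assoc, of_comp_mul, APath.comp_assoc]
        · simp only [sub_mul, smul_mul_assoc, of_mul_of_ne e, sub_zero, smul_zero]
          exact zero_mem _

variable (k A)

/-- The subspace `M`, as the two-sided ideal of `k[Γ, 𝒜]` that it is. -/
def linearityIdeal : TwoSidedIdeal (PathSpan k (APath A)) :=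
  TwoSidedIdeal.mk' (linearitySubmodule k A : Set (PathSpan k (APath A)))
    (zero_mem _) (fun hx hy => add_mem hx hy) (fun hx => neg_mem hx)
    (fun {x y} hy => mul_mem_linearitySubmodule_left x y hy)
    (fun {x y} hx => mul_mem_linearitySubmodule_right x y hx)

/-- The generalized path algebra `k(Γ, 𝒜) = k[Γ, 𝒜] / M`. -/
def GenPathAlgebra :=
  PathSpan k (APath A) ⧸ (linearityIdeal k A).asIdeal

instance : Ring (GenPathAlgebra k A) :=
  inferInstanceAs (Ring (PathSpan k (APath A) ⧸ (linearityIdeal k A).asIdeal))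

instance : Algebra k (GenPathAlgebra k A) :=
  inferInstanceAs (Algebra k (PathSpan k (APath A) ⧸ (linearityIdeal k A).asIdeal))

/-- The class of an `𝒜`-path in `k(Γ, 𝒜)`. -/
def ofAPath (k : Type u₁) [Field k] {V : Type u} [Quiver.{v} V] {A : V → Type w}
    [∀ i, Ring (A i)] [∀ i, Algebra k (A i)] [Fintype V] {i j : V} (p : APath A i j) :
    GenPathAlgebra k A :=
  Ideal.Quotient.mkₐ k (linearityIdeal k A).asIdeal (of k p)

end GPA

/-! ### The quiver `Γ[Σ₁, …, Σₙ]` -/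

/-- The vertices of `Γ[Σ₁, …, Σₙ]`: the disjoint union of the vertices of the `Σᵢ`. -/
def Glue {V : Type u} (S : V → Type u₂) := Σ i, S i

/-- The vertex `a` of `Σᵢ`, as a vertex of `Γ[Σ₁, …, Σₙ]`. -/
def Glue.mk {V : Type u} {S : V → Type u₂} (i : V) (a : S i) : Glue S := ⟨i, a⟩

instance {V : Type u} [Fintype V] (S : V → Type u₂) [∀ i, Fintype (S i)] : Fintype (Glue S) :=
  inferInstanceAs (Fintype (Σ i, S i))

/-- The arrows of `Γ[Σ₁, …, Σₙ]`: those of the `Σᵢ`, and, for every arrow `α : i → j` of `Γ` with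
`i ≠ j`, one arrow `α_{a,b} : a → b` for each vertex `a` of `Σᵢ` and each vertex `b` of `Σⱼ`. -/
inductive GlueHom {V : Type u} [Quiver.{v} V] (S : V → Type u₂) [∀ i, Quiver.{v₂} (S i)] :
    Glue S → Glue S → Type (max u v u₂ v₂)
  | inner {i : V} {a b : S i} (f : a ⟶ b) : GlueHom S (Glue.mk i a) (Glue.mk i b)
  | outer {i j : V} (h : i ≠ j) (α : i ⟶ j) (a : S i) (b : S j) : GlueHom S (Glue.mk i a) (Glue.mk j b)

section Glue

variable {V : Type u} [Quiver.{v} V] {S : V → Type u₂} [∀ i, Quiver.{v₂} (S i)]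

instance : Quiver.{max u v u₂ v₂} (Glue S) := ⟨GlueHom S⟩

/-- The inclusion of `Σᵢ` into `Γ[Σ₁, …, Σₙ]`. -/
def innerIncl (S : V → Type u₂) [∀ i, Quiver.{v₂} (S i)] (i : V) : S i ⥤q Glue S where
  obj a := Glue.mk i a
  map f := GlueHom.inner f

variable {k : Type u₁} [Field k]

/-- The inclusion `kΣᵢ → kΓ[Σ₁, …, Σₙ]`. -/
def innerMap (k : Type u₁) [Field k] (S : V → Type u₂) [∀ i, Quiver.{v₂} (S i)] (i : V) :
    PathAlgebra k (S i) →ₗ[k] PathAlgebra k (Glue S) :=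
  PathSpan.lift fun _ _ p => ofPath k ((innerIncl S i).mapPath p)

variable [Fintype V] [∀ i, Fintype (S i)]

/-- The ideal `(Ω₁, …, Ωₙ)` of `kΓ[Σ₁, …, Σₙ]`. -/
def glueIdeal (Ω : ∀ i, TwoSidedIdeal (PathAlgebra k (S i))) :
    TwoSidedIdeal (PathAlgebra k (Glue S)) :=
  TwoSidedIdeal.span {x | ∃ i, ∃ y ∈ Ω i, x = innerMap k S i y}

/-- The bound path algebra `Aᵢ = kΣᵢ/Ωᵢ`. -/
def VertexAlgebra (Ω : ∀ i, TwoSidedIdeal (PathAlgebra k (S i))) (i : V) :=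
  PathAlgebra k (S i) ⧸ (Ω i).asIdeal

instance (Ω : ∀ i, TwoSidedIdeal (PathAlgebra k (S i))) (i : V) : Ring (VertexAlgebra Ω i) :=
  inferInstanceAs (Ring (PathAlgebra k (S i) ⧸ (Ω i).asIdeal))

instance (Ω : ∀ i, TwoSidedIdeal (PathAlgebra k (S i))) (i : V) : Algebra k (VertexAlgebra Ω i) :=
  inferInstanceAs (Algebra k (PathAlgebra k (S i) ⧸ (Ω i).asIdeal))

/-- The canonical projection `kΣᵢ → kΣᵢ/Ωᵢ`. -/
def vertexProj (Ω : ∀ i, TwoSidedIdeal (PathAlgebra k (S i))) (i : V) :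
    PathAlgebra k (S i) →ₐ[k] VertexAlgebra Ω i :=
  Ideal.Quotient.mkₐ k (Ω i).asIdeal

end Glue

/-! ### Relations induced by relations on `Γ` -/

/-- A path `β₁ … βᵣ` of `Γ` (`r ≥ 1`), with a path `γⱼ` of `Σ_{e(βⱼ)}` inserted between `βⱼ` and
`βⱼ₊₁` for each `1 ≤ j < r`: a sequence `β₁ γ₁ β₂ … γᵣ₋₁ βᵣ`. -/
inductive DecoratedPath {V : Type u} [Quiver.{v} V] (S : V → Type u₂) [∀ i, Quiver.{v₂} (S i)]
    (i : V) : V → Type (max u v u₂ v₂)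
  | single {j : V} (β : i ⟶ j) : DecoratedPath S i j
  | cons {j l : V} (d : DecoratedPath S i j) {a b : S j} (γ : Quiver.Path a b) (β : j ⟶ l) :
      DecoratedPath S i l

namespace DecoratedPath

variable {V : Type u} [Quiver.{v} V] {S : V → Type u₂} [∀ i, Quiver.{v₂} (S i)]

/-- The path `β₁ … βᵣ` underlying `β₁ γ₁ β₂ … γᵣ₋₁ βᵣ`. -/
def underlying {i : V} : ∀ {j : V}, DecoratedPath S i j → Quiver.Path i j
  | _, single β => β.toPath
  | _, cons d _ β => d.underlying.cons β

/-- The path `(β₁)_{x,s(γ₁)} γ₁ (β₂)_{e(γ₁),s(γ₂)} γ₂ … γᵣ₋₁ (βᵣ)_{e(γᵣ₋₁),y}` of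
`Γ[Σ₁, …, Σₙ]`. -/
def toGluePath (hΓ : IsAcyclic V) {i : V} (x : S i) :
    ∀ {j : V}, DecoratedPath S i j → ∀ y : S j,
      Quiver.Path (Glue.mk i x) (Glue.mk j y)
  | _, single β, y => Quiver.Path.nil.cons (GlueHom.outer (hΓ.ne β) β x y)
  | _, cons (a := a) (b := b) d γ β, y =>
      ((d.toGluePath hΓ x a).comp ((innerIncl S _).mapPath γ)).cons
        (GlueHom.outer (hΓ.ne β) β b y)

variable {k : Type u₁} [Field k] [∀ i, Fintype (S i)]

/-- The `𝒜`-path `β₁ γ̄₁ β₂ … γ̄ᵣ₋₁ βᵣ`, where `γ̄ⱼ` is the class of `γⱼ` in `kΣ/Ω`. -/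
def toAPath (Ω : ∀ i, TwoSidedIdeal (PathAlgebra k (S i))) {i : V} :
    ∀ {j : V}, DecoratedPath S i j → APath (VertexAlgebra Ω) i j
  | _, single β => (APath.nil 1).cons β 1
  | _, cons d γ β =>
      ((d.toAPath Ω).rmul (vertexProj Ω _ (ofPath k γ))).cons β 1

end DecoratedPath

section Induced

variable {k : Type u₁} [Field k] {V : Type u} [Quiver.{v} V] [Fintype V]
  {S : V → Type u₂} [∀ i, Quiver.{v₂} (S i)] [∀ i, Fintype (S i)]

/-- The set `𝒜(I) ⊆ k(Γ, 𝒜)`: the elements obtained from a relation `∑ λ_p p` in `I` by replacing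
every path `p` that occurs in it by an `𝒜`-path of the form `β₁ γ̄₁ β₂ … γ̄ᵣ₋₁ βᵣ`, where
`p = β₁ … βᵣ`; the `γⱼ` are chosen independently for the different `p`. -/
def inducedARelations (Ω : ∀ i, TwoSidedIdeal (PathAlgebra k (S i))) (I : Set (PathAlgebra k V)) :
    Set (GenPathAlgebra k (VertexAlgebra Ω)) :=
  {x | ∃ (l l' : V) (ρ : Quiver.Path l l' →₀ k) (d : Quiver.Path l l' → DecoratedPath S l l'),
    combination ρ ∈ I ∧ (∀ p ∈ ρ.support, (d p).underlying = p) ∧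
    x = ∑ p ∈ ρ.support, ρ p • ofAPath k ((d p).toAPath Ω)}

/-- The gbp-algebra `k(Γ, 𝒜, I) = k(Γ, 𝒜)/(𝒜(I))`. -/
def GBPAlgebra (Ω : ∀ i, TwoSidedIdeal (PathAlgebra k (S i))) (I : Set (PathAlgebra k V)) :=
  GenPathAlgebra k (VertexAlgebra Ω) ⧸ (TwoSidedIdeal.span (inducedARelations Ω I)).asIdeal

instance (Ω : ∀ i, TwoSidedIdeal (PathAlgebra k (S i))) (I : Set (PathAlgebra k V)) :
    Ring (GBPAlgebra Ω I) :=
  inferInstanceAs (Ring (GenPathAlgebra k (VertexAlgebra Ω) ⧸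
    (TwoSidedIdeal.span (inducedARelations Ω I)).asIdeal))

instance (Ω : ∀ i, TwoSidedIdeal (PathAlgebra k (S i))) (I : Set (PathAlgebra k V)) :
    Algebra k (GBPAlgebra Ω I) :=
  inferInstanceAs (Algebra k (GenPathAlgebra k (VertexAlgebra Ω) ⧸
    (TwoSidedIdeal.span (inducedARelations Ω I)).asIdeal))

/-- The set `R(I)` of relations of `Γ[Σ₁, …, Σₙ]` induced by `I`. -/
def inducedRelations (hΓ : IsAcyclic V) (S : V → Type u₂) [∀ i, Quiver.{v₂} (S i)]
    (I : Set (PathAlgebra k V)) : Set (PathAlgebra k (Glue S)) :=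
  {x | ∃ (l l' : V) (ρ : Quiver.Path l l' →₀ k) (d : Quiver.Path l l' → DecoratedPath S l l')
      (a : S l) (b : S l'),
    combination ρ ∈ I ∧ (∀ p ∈ ρ.support, (d p).underlying = p) ∧
    x = ∑ p ∈ ρ.support, ρ p • ofPath k ((d p).toGluePath hΓ a b)}

/-- The ideal `L(I)` of `kΓ[Σ₁, …, Σₙ]` generated by `R(I)`. -/
def inducedIdeal (hΓ : IsAcyclic V) (S : V → Type u₂) [∀ i, Quiver.{v₂} (S i)]
    [∀ i, Fintype (S i)] (I : Set (PathAlgebra k V)) : TwoSidedIdeal (PathAlgebra k (Glue S)) :=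
  TwoSidedIdeal.span (inducedRelations hΓ S I)

end Induced

end GBP

end

noncomputable section

namespace GBP

universe u v w u₁ v₁ u₂ v₂

open PathSpan

/-! The isomorphism comes from two homomorphisms defined on generators. Write `e_a` for the trivial
path at a vertex `a` of `Σᵢ`, and also for its class in `Aᵢ`. The map `glueToGen : kΓ[Σ₁, …, Σₙ] →
k(Γ, 𝒜)` sends paths of `Σᵢ` to their classes in `Aᵢ` and `α_{a,b}` to `e_a α e_b`. In the other
direction, `genToGlue` includes `Aᵢ` through `Σᵢ` and sends `α` to the sum of all `α_{a,b}`. The two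
are inverse modulo `(Ω₁, …, Ωₙ)`, because `1 ∈ Aᵢ` is the sum of the orthogonal idempotents `e_a`:
cutting the sum with `e_a` and `e_b` isolates `α_{a,b}`, and summing `e_a α e_b` over `a` and `b`
restores `α`.

The induced relations correspond in the same way. The idempotents at the ends of an inserted path
`γ` are absorbed by `γ`, so a generator of `L(I)` with end points `x, y` maps to `e_x r e_y` with `r
∈ 𝒜(I)` (`glueToGen_inducedRelation`). Conversely `r = ∑ e_x r e_y`. Hence both maps descend to the
quotients.

For admissibility, `Jⁿ` is spanned by the paths of length at least `n`. A path of `Γ[Σ₁, …, Σₙ]`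
alternates between runs inside some `Σᵢ` and arrows `α_{a,b}`. A long run lies in `Ωᵢ`, and
acyclicity of `Γ` bounds the number of arrows `α_{a,b}`, so every sufficiently long path lies in
`(Ω₁, …, Ωₙ)` (`ofPath_mem_glueIdeal_or_exists_comp`). Containment in `J²` is checked on generators:
inserting paths never shortens a path, and no path of length less than two occurs in an element of
an admissible ideal (`two_le_length_of_combination_mem`). -/

/-! ### Factoring through surjections, kernels, and maps out of a span of paths -/

theorem exists_factor_of_surjective {k M N X : Type*} [Ring k] [AddCommGroup M] [Module k M]
    [AddCommGroup N] [Module k N] [AddCommGroup X] [Module k X] (π : M →ₗ[k] N)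
    (hπ : Function.Surjective π) (f : M →ₗ[k] X) (h : ∀ m, π m = 0 → f m = 0) :
    ∃ g : N →ₗ[k] X, ∀ m, g (π m) = f m := by
  refine ⟨(LinearMap.ker π).liftQ f (fun m hm => h m hm) ∘ₗ
    (π.quotKerEquivOfSurjective hπ).symm.toLinearMap, fun m => ?_⟩
  have : (π.quotKerEquivOfSurjective hπ).symm (π m) = (LinearMap.ker π).mkQ m := by
    rw [LinearEquiv.symm_apply_eq]; rfl
  simp only [LinearMap.comp_apply, LinearEquiv.coe_coe, this]
  rfl

theorem span_le_of_map_eq_zero {R R' : Type*} [Ring R] [Ring R'] {s : Set R} (f : R →+* R')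
    (h : ∀ x ∈ s, f x = 0) {x : R} (hx : x ∈ TwoSidedIdeal.span s) : f x = 0 := by
  have : TwoSidedIdeal.span s ≤ TwoSidedIdeal.ker f :=
    TwoSidedIdeal.span_le.2 fun y hy => (TwoSidedIdeal.mem_ker f).2 (h y hy)
  exact (TwoSidedIdeal.mem_ker f).1 (this hx)

theorem sup_map_eq_zero {R R' : Type*} [Ring R] [Ring R'] {K L : TwoSidedIdeal R} (f : R →+* R')
    (hK : ∀ x ∈ K, f x = 0) (hL : ∀ x ∈ L, f x = 0) {x : R} (hx : x ∈ K ⊔ L) : f x = 0 := by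
  have : K ⊔ L ≤ TwoSidedIdeal.ker f :=
    sup_le (fun y hy => (TwoSidedIdeal.mem_ker f).2 (hK y hy))
      (fun y hy => (TwoSidedIdeal.mem_ker f).2 (hL y hy))
  exact (TwoSidedIdeal.mem_ker f).1 (this hx)

/-- The algebra homomorphism out of the span of composable paths determined by its values. -/
def PathSpan.liftAlgHom {k : Type u₁} [Field k] {V : Type u} [Fintype V] {P : V → V → Type w}
    [PathSystem P] {R : Type*} [Ring R] [Algebra k R] (f : ∀ i j, P i j → R)
    (h1 : ∑ i, f i i (PathSystem.nil' i) = 1)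
    (hcomp : ∀ {i j l} (p : P i j) (q : P j l), f i l (PathSystem.comp' p q) = f i j p * f j l q)
    (hne : ∀ {i j j' l} (p : P i j) (q : P j' l), j ≠ j' → f i j p * f j' l q = 0) :
    PathSpan k P →ₐ[k] R :=
  AlgHom.ofLinearMap (PathSpan.lift f)
    (by rw [PathSpan.one_def, map_sum]; simpa using h1)
    (by
      intro x y
      induction x using PathSpan.induct with
      | h0 => simp
      | hadd x₁ x₂ h₁ h₂ => simp only [add_mul, map_add, h₁, h₂]
      | hsmul c x₁ h₁ => simp only [smul_mul_assoc, map_smul, h₁]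
      | hof i j p =>
      induction y using PathSpan.induct with
      | h0 => simp
      | hadd x₁ x₂ h₁ h₂ => simp only [mul_add, map_add, h₁, h₂]
      | hsmul c x₁ h₁ => simp only [mul_smul_comm, map_smul, h₁]
      | hof j' l q =>
        by_cases e : j = j'
        · subst e
          simp only [PathSpan.of_mul_of, PathSpan.lift_of, hcomp]
        · simp only [PathSpan.of_mul_of_ne e, PathSpan.lift_of, hne p q e, map_zero])

theorem PathSpan.liftAlgHom_of {k : Type u₁} [Field k] {V : Type u} [Fintype V]
    {P : V → V → Type w} [PathSystem P] {R : Type*} [Ring R] [Algebra k R] (f : ∀ i j, P i j → R)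
    (h1 : ∑ i, f i i (PathSystem.nil' i) = 1)
    (hcomp : ∀ {i j l} (p : P i j) (q : P j l), f i l (PathSystem.comp' p q) = f i j p * f j l q)
    (hne : ∀ {i j j' l} (p : P i j) (q : P j' l), j ≠ j' → f i j p * f j' l q = 0)
    {i j : V} (p : P i j) :
    PathSpan.liftAlgHom (k := k) f h1 hcomp hne (PathSpan.of k p) = f i j p :=
  PathSpan.lift_of f p

theorem PathSpan.algHom_ext {k : Type u₁} [Field k] {V : Type u} [Fintype V]
    {P : V → V → Type w} [PathSystem P] {R : Type*} [Ring R] [Algebra k R]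
    {f g : PathSpan k P →ₐ[k] R} (h : ∀ i j (p : P i j), f (of k p) = g (of k p)) : f = g :=
  AlgHom.toLinearMap_injective (PathSpan.hom_ext h)

/-! ### Homomorphisms out of a path algebra -/

section PathVal

variable {k : Type u₁} [Field k] {Q : Type u} [Quiver.{v} Q] {R : Type*} [Ring R] [Algebra k R]

theorem ofPath_comp {a b c : Q} (p : Quiver.Path a b) (q : Quiver.Path b c) :
    ofPath k (p.comp q) = ofPath k p * ofPath k q :=
  (PathSpan.of_mul_of (P := fun a b : Q => Quiver.Path a b) p q).symm

theorem ofPath_cons {a b c : Q} (p : Quiver.Path a b) (f : b ⟶ c) :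
    ofPath k (p.cons f) = ofPath k p * ofPath k f.toPath :=
  ofPath_comp p f.toPath

theorem ofPath_mul_of_ne {a b b' c : Q} (h : b ≠ b') (p : Quiver.Path a b)
    (q : Quiver.Path b' c) : ofPath k p * ofPath k q = 0 :=
  PathSpan.of_mul_of_ne h p q

/-- The product of the values of the arrows of a path. -/
def pathVal (E : Q → R) (g : ∀ a b : Q, (a ⟶ b) → R) {a : Q} : ∀ {b : Q}, Quiver.Path a b → R
  | _, .nil => E a
  | _, .cons p f => pathVal E g p * g _ _ f

variable {E : Q → R} {g : ∀ a b : Q, (a ⟶ b) → R}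

theorem pathVal_mul_idem (hE : ∀ a, E a * E a = E a) (hg : ∀ a b (f : a ⟶ b), g a b f * E b = g a b f)
    {a b : Q} (p : Quiver.Path a b) : pathVal E g p * E b = pathVal E g p := by
  cases p with
  | nil => exact hE a
  | cons p f => rw [pathVal, mul_assoc, hg]

/-- No compatibility of `g` with the starts of arrows is needed: the value of every path begins with
the factor `E a`. -/
theorem idem_mul_pathVal (hE : ∀ a, E a * E a = E a)
    {a b : Q} (p : Quiver.Path a b) : E a * pathVal E g p = pathVal E g p := by
  induction p with
  | nil => exact hE a
  | cons p f ih => rw [pathVal, ← mul_assoc, ih]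

theorem pathVal_comp (hE : ∀ a, E a * E a = E a) (hg : ∀ a b (f : a ⟶ b), g a b f * E b = g a b f)
    {a b c : Q} (p : Quiver.Path a b) (q : Quiver.Path b c) :
    pathVal E g (p.comp q) = pathVal E g p * pathVal E g q := by
  induction q with
  | nil => exact (pathVal_mul_idem hE hg p).symm
  | cons q f ih => rw [Quiver.Path.comp_cons, pathVal, pathVal, ih, mul_assoc]

/-- The first value absorbs `E b` on its right and the second `E b'` on its left, and these are
orthogonal. -/
theorem pathVal_mul_of_ne (hE : ∀ a, E a * E a = E a) (hne : ∀ a b, a ≠ b → E a * E b = 0)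
    (hg : ∀ a b (f : a ⟶ b), g a b f * E b = g a b f)
    {a b b' c : Q} (p : Quiver.Path a b) (q : Quiver.Path b' c) (h : b ≠ b') :
    pathVal E g p * pathVal E g q = 0 := by
  rw [← pathVal_mul_idem hE hg p, ← idem_mul_pathVal hE q, mul_assoc, ← mul_assoc (E b), hne b b' h,
    zero_mul, mul_zero]

/-- The homomorphism out of a path algebra determined by its values on vertices and arrows. -/
def pathAlgebraLift [Fintype Q] (E : Q → R) (g : ∀ a b : Q, (a ⟶ b) → R)
    (h1 : ∑ a, E a = 1) (hE : ∀ a, E a * E a = E a) (hne : ∀ a b, a ≠ b → E a * E b = 0)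
    (hg : ∀ a b (f : a ⟶ b), g a b f * E b = g a b f) : PathAlgebra k Q →ₐ[k] R :=
  PathSpan.liftAlgHom (fun _ _ p => pathVal E g p) h1 (pathVal_comp hE hg)
    (pathVal_mul_of_ne hE hne hg)

theorem pathAlgebraLift_ofPath [Fintype Q] (h1 : ∑ a, E a = 1) (hE : ∀ a, E a * E a = E a)
    (hne : ∀ a b, a ≠ b → E a * E b = 0) (hg : ∀ a b (f : a ⟶ b), g a b f * E b = g a b f)
    {a b : Q} (p : Quiver.Path a b) :
    pathAlgebraLift E g h1 hE hne hg (ofPath k p) = pathVal E g p :=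
  PathSpan.liftAlgHom_of (fun _ _ p => pathVal E g p) h1 (pathVal_comp hE hg)
    (pathVal_mul_of_ne hE hne hg) p

end PathVal

/-! ### Homomorphisms out of a generalized path algebra -/

section APathVal

variable {k : Type u₁} [Field k] {V : Type u} [Quiver.{v} V] {A : V → Type w}
  [∀ i, Ring (A i)] [∀ i, Algebra k (A i)]

/-- Specializes the linearity relations, stated for `p a q`, to a single element of `A i`; this
makes `A i → k(Γ, 𝒜)` linear. -/
theorem nil_comp_nil_comp_nil {i : V} (a : A i) :
    (APath.nil (1 : A i)).comp ((APath.nil a).comp (APath.nil 1)) = APath.nil a := by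
  rw [APath.nil_comp, APath.comp_nil]

variable {R : Type*} [Ring R] [Algebra k R]

/-- The product of the values of the entries and arrows of an `𝒜`-path. -/
def apathVal (ι : ∀ i, A i →ₗ[k] R) (g : ∀ i j : V, (i ⟶ j) → R) {i : V} :
    ∀ {j : V}, APath A i j → R
  | _, .nil a => ι i a
  | _, .cons p β a => apathVal ι g p * g _ _ β * ι _ a

variable {ι : ∀ i, A i →ₗ[k] R} {g : ∀ i j : V, (i ⟶ j) → R}

theorem apathVal_rmul (hι : ∀ i (a b : A i), ι i (a * b) = ι i a * ι i b) {i j : V}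
    (p : APath A i j) (a : A j) : apathVal ι g (p.rmul a) = apathVal ι g p * ι j a := by
  cases p with
  | nil b => exact hι _ _ _
  | cons p β b => simp only [APath.rmul, apathVal, hι, mul_assoc]

theorem apathVal_comp (hι : ∀ i (a b : A i), ι i (a * b) = ι i a * ι i b) {i j l : V}
    (p : APath A i j) (q : APath A j l) :
    apathVal ι g (p.comp q) = apathVal ι g p * apathVal ι g q := by
  induction q with
  | nil b => exact apathVal_rmul hι p b
  | cons q β b ih => simp only [APath.comp, apathVal, ih, mul_assoc]

theorem apathVal_mul_of_ne (hι : ∀ i (a b : A i), ι i (a * b) = ι i a * ι i b)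
    (hne : ∀ i j, i ≠ j → ι i 1 * ι j 1 = 0) {i j j' l : V}
    (p : APath A i j) (q : APath A j' l) (h : j ≠ j') :
    apathVal ι g p * apathVal ι g q = 0 := by
  rw [← APath.comp_nil p, ← APath.nil_comp q, apathVal_comp hι, apathVal_comp hι, mul_assoc,
    ← mul_assoc (apathVal ι g (APath.nil 1))]
  simp only [apathVal, hne j j' h, zero_mul, mul_zero]

end APathVal

section GPA

variable {k : Type u₁} [Field k] {V : Type u} [Quiver.{v} V] {A : V → Type w}
  [∀ i, Ring (A i)] [∀ i, Algebra k (A i)] [Fintype V]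

theorem ofAPath_comp {i j l : V} (p : APath A i j) (q : APath A j l) :
    ofAPath k (p.comp q) = ofAPath k p * ofAPath k q := by
  unfold ofAPath
  rw [← of_comp_mul]; exact map_mul _ _ _

theorem ofAPath_mul_of_ne {i j j' l : V} (h : j ≠ j') (p : APath A i j) (q : APath A j' l) :
    ofAPath k p * ofAPath k q = 0 := by
  have := map_mul (Ideal.Quotient.mkₐ k (linearityIdeal k A).asIdeal) (of k p) (of k q)
  rw [of_mul_of_ne h, map_zero] at this
  exact this.symm

theorem mk_linearity_eq_zero {x : PathSpan k (APath A)} (hx : x ∈ linearityRelations k A) :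
    Ideal.Quotient.mkₐ k (linearityIdeal k A).asIdeal x = 0 := by
  rw [Ideal.Quotient.mkₐ_eq_mk, Ideal.Quotient.eq_zero_iff_mem, TwoSidedIdeal.mem_asIdeal]
  exact (TwoSidedIdeal.mem_mk' _ _ _ _ _ _ _).2 (Submodule.subset_span hx)

variable (k A) in
/-- The inclusion of `A i` into the generalized path algebra. -/
def vertexIncl (i : V) : A i →ₗ[k] GenPathAlgebra k A where
  toFun a := ofAPath k (APath.nil a)
  map_add' a b := by
    have := mk_linearity_eq_zero (k := k) (A := A)
      (Or.inl ⟨i, i, i, APath.nil 1, APath.nil 1, a, b, rfl⟩)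
    simp only [nil_comp_nil_comp_nil, map_sub, map_add] at this
    exact sub_eq_zero.1 this
  map_smul' c a := by
    have := mk_linearity_eq_zero (k := k) (A := A)
      (Or.inr ⟨i, i, i, APath.nil 1, APath.nil 1, c, a, rfl⟩)
    simp only [nil_comp_nil_comp_nil, map_sub, map_smul] at this
    exact sub_eq_zero.1 this

variable (k A) in
/-- An arrow of `Γ` as an element of the generalized path algebra. -/
def arrowIncl {i j : V} (β : i ⟶ j) : GenPathAlgebra k A :=
  ofAPath k ((APath.nil 1).cons β 1)

theorem ofAPath_nil {i : V} (a : A i) : ofAPath k (APath.nil a) = vertexIncl k A i a := rfl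

theorem ofAPath_rmul {i j : V} (p : APath A i j) (a : A j) :
    ofAPath k (p.rmul a) = ofAPath k p * vertexIncl k A j a :=
  ofAPath_comp p (APath.nil a)

/-- The vertex algebras and the arrows generate `k(Γ, 𝒜)`; this recursion is what
`GenPathAlgebra.algHom_ext` rests on. -/
theorem ofAPath_cons {i j l : V} (p : APath A i j) (β : j ⟶ l) (a : A l) :
    ofAPath k (p.cons β a) = ofAPath k p * arrowIncl k A β * vertexIncl k A l a := by
  rw [← ofAPath_nil, arrowIncl, ← ofAPath_comp, ← ofAPath_comp]
  simp only [APath.comp, APath.rmul, one_mul]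
  congr 2
  exact (APath.comp_nil p).symm

theorem vertexIncl_mul {i : V} (a b : A i) :
    vertexIncl k A i (a * b) = vertexIncl k A i a * vertexIncl k A i b :=
  ofAPath_comp (APath.nil a) (APath.nil b)

theorem vertexIncl_mul_of_ne {i j : V} (h : i ≠ j) (a : A i) (b : A j) :
    vertexIncl k A i a * vertexIncl k A j b = 0 :=
  ofAPath_mul_of_ne h _ _

theorem one_mul_arrowIncl {i j : V} (β : i ⟶ j) :
    vertexIncl k A i 1 * arrowIncl k A β = arrowIncl k A β := by
  rw [← ofAPath_nil, arrowIncl, ← ofAPath_comp, APath.nil_comp]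

theorem arrowIncl_mul_one {i j : V} (β : i ⟶ j) :
    arrowIncl k A β * vertexIncl k A j 1 = arrowIncl k A β := by
  rw [← ofAPath_nil, arrowIncl, ← ofAPath_comp, APath.comp_nil]

theorem sum_vertexIncl_one : ∑ i, vertexIncl k A i 1 = 1 := by
  have := map_one (Ideal.Quotient.mkₐ k (linearityIdeal k A).asIdeal)
  rw [PathSpan.one_def, map_sum] at this
  exact this

theorem ofAPath_mul_one {i j : V} (p : APath A i j) :
    ofAPath k p * vertexIncl k A j 1 = ofAPath k p := by
  rw [← ofAPath_nil, ← ofAPath_comp, APath.comp_nil]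

theorem one_mul_ofAPath {i j : V} (p : APath A i j) :
    vertexIncl k A i 1 * ofAPath k p = ofAPath k p := by
  rw [← ofAPath_nil, ← ofAPath_comp, APath.nil_comp]

theorem GenPathAlgebra.algHom_ext {R : Type*} [Ring R] [Algebra k R]
    {f g : GenPathAlgebra k A →ₐ[k] R}
    (hv : ∀ i (a : A i), f (vertexIncl k A i a) = g (vertexIncl k A i a))
    (ha : ∀ (i j : V) (β : i ⟶ j), f (arrowIncl k A β) = g (arrowIncl k A β)) : f = g := by
  refine Ideal.Quotient.algHom_ext k (PathSpan.algHom_ext fun i j p => ?_)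
  change f (ofAPath k p) = g (ofAPath k p)
  induction p with
  | nil a => exact hv _ _
  | cons p β a ih => rw [ofAPath_cons, map_mul, map_mul, map_mul, map_mul, ih, hv, ha]

variable {R : Type*} [Ring R] [Algebra k R] {ι : ∀ i, A i →ₗ[k] R} {g : ∀ i j : V, (i ⟶ j) → R}

/-- The homomorphism out of a generalized path algebra determined by its values on the vertex
algebras and on the arrows. -/
def genPathAlgebraLift (ι : ∀ i, A i →ₗ[k] R) (g : ∀ i j : V, (i ⟶ j) → R)
    (h1 : ∑ i, ι i 1 = 1) (hι : ∀ i (a b : A i), ι i (a * b) = ι i a * ι i b)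
    (hne : ∀ i j, i ≠ j → ι i 1 * ι j 1 = 0) : GenPathAlgebra k A →ₐ[k] R :=
  Ideal.Quotient.liftₐ (linearityIdeal k A).asIdeal
    (PathSpan.liftAlgHom (fun _ _ p => apathVal ι g p) h1 (apathVal_comp hι)
      (apathVal_mul_of_ne hι hne))
    (by
      intro x hx
      rw [TwoSidedIdeal.mem_asIdeal] at hx
      replace hx : x ∈ linearitySubmodule k A := (TwoSidedIdeal.mem_mk' _ _ _ _ _ _ _).1 hx
      have hF : ∀ {i j} (p : APath A i j), PathSpan.liftAlgHom (k := k) (fun _ _ p => apathVal ι g p)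
          h1 (apathVal_comp hι) (apathVal_mul_of_ne hι hne) (of k p) = apathVal ι g p :=
        PathSpan.liftAlgHom_of _ _ _ _
      -- From here on only the linearity of the map and its values on `𝒜`-paths matter.
      generalize PathSpan.liftAlgHom (k := k) (fun _ _ p => apathVal ι g p) h1 (apathVal_comp hι)
        (apathVal_mul_of_ne hι hne) = F at hF
      induction hx using Submodule.span_induction with
      | zero => exact map_zero _
      | add x y _ _ h₁ h₂ => rw [map_add, h₁, h₂, add_zero]
      | smul c x _ h => rw [map_smul, h, smul_zero]
      | mem x h =>
        -- The value of `p a q` is the value of `p` times `ι a` times the value of `q`, hence linear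
        -- in `a`.
        rcases h with ⟨i, j, l, p, q, a, b, rfl⟩ | ⟨i, j, l, p, q, c, a, rfl⟩
        · simp only [map_sub, map_add, hF, apathVal_comp hι, apathVal,
            map_add, add_mul, mul_add, sub_self]
        · simp only [map_sub, map_smul, hF, apathVal_comp hι, apathVal,
            smul_mul_assoc, mul_smul_comm, sub_self])

variable (h1 : ∑ i, ι i 1 = 1) (hι : ∀ i (a b : A i), ι i (a * b) = ι i a * ι i b)
  (hne : ∀ i j, i ≠ j → ι i 1 * ι j 1 = 0)

theorem genPathAlgebraLift_ofAPath {i j : V} (p : APath A i j) :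
    genPathAlgebraLift ι g h1 hι hne (ofAPath k p) = apathVal ι g p := by
  have := PathSpan.liftAlgHom_of (k := k) (fun _ _ p => apathVal ι g p) h1 (apathVal_comp hι)
      (apathVal_mul_of_ne hι hne) p
  exact this

end GPA

/-! ### From the path algebra of `Γ[Σ₁, …, Σₙ]` to the generalized path algebra -/

section GlueToGen

theorem one_eq_sum_ofPath_nil {k : Type u₁} [Field k] {Q : Type*} [Quiver Q] [Fintype Q] :
    (1 : PathAlgebra k Q) = ∑ a : Q, ofPath k (Quiver.Path.nil : Quiver.Path a a) := rfl

theorem sum_glue {V : Type u} [Fintype V] {S : V → Type u₂} [∀ i, Fintype (S i)]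
    {M : Type*} [AddCommMonoid M] (f : Glue S → M) :
    ∑ x, f x = ∑ i, ∑ a : S i, f (Glue.mk i a) :=
  Fintype.sum_sigma f

theorem vertexProj_surjective {k : Type u₁} [Field k] {V : Type u} {S : V → Type u₂}
    [∀ i, Quiver.{v₂} (S i)] [∀ i, Fintype (S i)] (Ω : ∀ i, TwoSidedIdeal (PathAlgebra k (S i))) (i : V) :
    Function.Surjective (vertexProj Ω i) :=
  Ideal.Quotient.mkₐ_surjective _ _

theorem vertexProj_eq_zero_iff {k : Type u₁} [Field k] {V : Type u} {S : V → Type u₂}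
    [∀ i, Quiver.{v₂} (S i)] [∀ i, Fintype (S i)] (Ω : ∀ i, TwoSidedIdeal (PathAlgebra k (S i))) (i : V)
    (x : PathAlgebra k (S i)) : vertexProj Ω i x = 0 ↔ x ∈ Ω i := by
  rw [← TwoSidedIdeal.mem_asIdeal]
  exact Ideal.Quotient.eq_zero_iff_mem

variable {k : Type u₁} [Field k] {V : Type u} [Quiver.{v} V] {S : V → Type u₂}
  [∀ i, Quiver.{v₂} (S i)]

/-- A path of `Σᵢ`, as a path of `Γ[Σ₁, …, Σₙ]`. -/
def innerPath {i : V} {a b : S i} (p : Quiver.Path a b) :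
    Quiver.Path (Glue.mk (S := S) i a) (Glue.mk i b) :=
  (innerIncl S i).mapPath p

/-- An arrow of `Σᵢ`, as an arrow of `Γ[Σ₁, …, Σₙ]`. -/
def innerArrow {i : V} {a b : S i} (f : a ⟶ b) : Glue.mk (S := S) i a ⟶ Glue.mk i b :=
  GlueHom.inner f

/-- The arrow `α_{a,b}` of `Γ[Σ₁, …, Σₙ]`. -/
def outerArrow {i j : V} (h : i ≠ j) (α : i ⟶ j) (a : S i) (b : S j) :
    Glue.mk (S := S) i a ⟶ Glue.mk j b :=
  GlueHom.outer h α a b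

theorem innerPath_cons {i : V} {a b c : S i} (p : Quiver.Path a b) (f : b ⟶ c) :
    innerPath (p.cons f) = (innerPath p).cons (innerArrow f) := rfl

theorem innerPath_comp {i : V} {a b c : S i} (p : Quiver.Path a b) (q : Quiver.Path b c) :
    innerPath (p.comp q) = (innerPath p).comp (innerPath q) :=
  Prefunctor.mapPath_comp _ p q

theorem length_innerPath {i : V} {a b : S i} (p : Quiver.Path a b) :
    (innerPath p).length = p.length := by
  induction p with
  | nil => rfl
  | cons p f ih => rw [innerPath_cons, Quiver.Path.length_cons, Quiver.Path.length_cons, ih]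

theorem Glue.hom_cases {motive : ∀ {x y : Glue S}, (x ⟶ y) → Prop}
    (inner : ∀ {i : V} {a b : S i} (f : a ⟶ b), motive (innerArrow f))
    (outer : ∀ {i j : V} (h : i ≠ j) (α : i ⟶ j) (a : S i) (b : S j),
      motive (outerArrow h α a b))
    {x y : Glue S} (f : x ⟶ y) : motive f :=
  GlueHom.casesOn (motive := fun _ _ f => motive f) f inner outer

theorem DecoratedPath.toGluePath_cons (hΓ : IsAcyclic V) {i j l : V} (x : S i) (y : S l)
    (d : DecoratedPath S i j) {a b : S j} (γ : Quiver.Path a b) (β : j ⟶ l) :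
    (d.cons γ β).toGluePath hΓ x y =
      ((d.toGluePath hΓ x a).comp (innerPath γ)).cons (outerArrow (hΓ.ne β) β b y) := rfl

theorem innerMap_ofPath {i : V} {a b : S i} (p : Quiver.Path a b) :
    innerMap k S i (ofPath k p) = ofPath k (innerPath p) :=
  PathSpan.lift_of _ p

variable [∀ i, Fintype (S i)] [Fintype V]

theorem innerMap_mul {i : V} (x y : PathAlgebra k (S i)) :
    innerMap k S i (x * y) = innerMap k S i x * innerMap k S i y := by
  induction x using PathSpan.induct with
  | h0 => simp only [zero_mul, map_zero]
  | hadd x₁ x₂ h₁ h₂ => simp only [add_mul, map_add, h₁, h₂]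
  | hsmul c x₁ h₁ => simp only [smul_mul_assoc, map_smul, h₁]
  | hof a b p =>
  induction y using PathSpan.induct with
  | h0 => simp only [mul_zero, map_zero]
  | hadd x₁ x₂ h₁ h₂ => simp only [mul_add, map_add, h₁, h₂]
  | hsmul c x₁ h₁ => simp only [mul_smul_comm, map_smul, h₁]
  | hof b' c q =>
    by_cases e : b = b'
    · subst e
      rw [← ofPath_comp, innerMap_ofPath, innerMap_ofPath, innerMap_ofPath, innerPath_comp,
        ofPath_comp]
    · have e' : Glue.mk (S := S) i b ≠ Glue.mk i b' := fun h => e (eq_of_heq (Sigma.mk.inj h).2)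
      rw [ofPath_mul_of_ne e, innerMap_ofPath, innerMap_ofPath, map_zero]
      exact (ofPath_mul_of_ne e' _ _).symm

variable (Ω : ∀ i, TwoSidedIdeal (PathAlgebra k (S i)))

/-- The class of a path of `Σᵢ` in the generalized path algebra. -/
def vertexPath (i : V) {a b : S i} (p : Quiver.Path a b) : GenPathAlgebra k (VertexAlgebra Ω) :=
  vertexIncl k (VertexAlgebra Ω) i (vertexProj Ω i (ofPath k p))

theorem vertexPath_comp (i : V) {a b c : S i} (p : Quiver.Path a b) (q : Quiver.Path b c) :
    vertexPath Ω i (p.comp q) = vertexPath Ω i p * vertexPath Ω i q := by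
  simp only [vertexPath, ofPath_comp, map_mul, vertexIncl_mul]

/-- The idempotent of the generalized path algebra at a vertex of `Γ[Σ₁, …, Σₙ]`. -/
def glueIdem (x : Glue S) : GenPathAlgebra k (VertexAlgebra Ω) :=
  vertexPath Ω x.1 (Quiver.Path.nil : Quiver.Path x.2 x.2)

/-- The value of an arrow of `Γ[Σ₁, …, Σₙ]` in the generalized path algebra. -/
def glueArrow : ∀ x y : Glue S, (x ⟶ y) → GenPathAlgebra k (VertexAlgebra Ω)
  | _, _, GlueHom.inner (i := i) f => vertexPath Ω i f.toPath
  | _, _, GlueHom.outer (i := i) (j := j) _ α a b =>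
      glueIdem Ω (Glue.mk i a) * arrowIncl k (VertexAlgebra Ω) α * glueIdem Ω (Glue.mk j b)

theorem glueIdem_mk (i : V) (a : S i) :
    glueIdem Ω (Glue.mk i a) = vertexPath Ω i (Quiver.Path.nil : Quiver.Path a a) := rfl

theorem glueArrow_outer {i j : V} (h : i ≠ j) (α : i ⟶ j) (a : S i) (b : S j) :
    glueArrow Ω _ _ (outerArrow h α a b) =
      glueIdem Ω (Glue.mk i a) * arrowIncl k (VertexAlgebra Ω) α * glueIdem Ω (Glue.mk j b) := rfl

theorem glueIdem_mul_self (x : Glue S) : glueIdem Ω x * glueIdem Ω x = glueIdem Ω x := by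
  rw [glueIdem, ← vertexPath_comp, Quiver.Path.nil_comp]

theorem glueIdem_mul_of_ne (x y : Glue S) (h : x ≠ y) : glueIdem Ω x * glueIdem Ω y = 0 := by
  obtain ⟨i, a⟩ := x
  obtain ⟨j, b⟩ := y
  by_cases e : i = j
  · subst e
    have e' : a ≠ b := fun e' => h (by rw [e'])
    simp only [glueIdem, vertexPath]
    rw [← vertexIncl_mul, ← map_mul, ofPath_mul_of_ne e', map_zero, map_zero]
  · exact vertexIncl_mul_of_ne e _ _

theorem glueArrow_mul_glueIdem (x y : Glue S) (f : x ⟶ y) :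
    glueArrow Ω x y f * glueIdem Ω y = glueArrow Ω x y f := by
  induction f using Glue.hom_cases with
  | inner f => exact (vertexPath_comp Ω _ _ _).symm
  | outer h α a b => simp only [glueArrow_outer, mul_assoc, glueIdem_mul_self]

theorem sum_glueIdem_vertex (i : V) :
    ∑ a : S i, glueIdem Ω (Glue.mk i a) = vertexIncl k (VertexAlgebra Ω) i 1 := by
  rw [← map_one (vertexProj Ω i), one_eq_sum_ofPath_nil, map_sum, map_sum]
  rfl

theorem sum_glueIdem : ∑ x : Glue S, glueIdem Ω x = 1 := by
  rw [sum_glue, ← sum_vertexIncl_one]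
  exact Finset.sum_congr rfl fun i _ => sum_glueIdem_vertex Ω i

/-- The homomorphism `kΓ[Σ₁, …, Σₙ] → k(Γ, 𝒜)`. -/
def glueToGen : PathAlgebra k (Glue S) →ₐ[k] GenPathAlgebra k (VertexAlgebra Ω) :=
  pathAlgebraLift (glueIdem Ω) (glueArrow Ω) (sum_glueIdem Ω) (glueIdem_mul_self Ω)
    (glueIdem_mul_of_ne Ω) (glueArrow_mul_glueIdem Ω)

theorem glueToGen_ofPath {x y : Glue S} (p : Quiver.Path x y) :
    glueToGen Ω (ofPath k p) = pathVal (glueIdem Ω) (glueArrow Ω) p :=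
  pathAlgebraLift_ofPath _ _ _ _ p

theorem glueToGen_inner {i : V} {a b : S i} (p : Quiver.Path a b) :
    glueToGen Ω (ofPath k (innerPath p)) = vertexPath Ω i p := by
  rw [glueToGen_ofPath]
  induction p with
  | nil => rfl
  | cons p f ih =>
    rw [innerPath_cons, pathVal, ih]
    exact (vertexPath_comp Ω i p f.toPath).symm

theorem glueToGen_innerMap {i : V} (x : PathAlgebra k (S i)) :
    glueToGen Ω (innerMap k S i x) = vertexIncl k (VertexAlgebra Ω) i (vertexProj Ω i x) := by
  induction x using PathSpan.induct with
  | h0 => simp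
  | hadd x y hx hy => simp only [map_add, hx, hy]
  | hsmul c x hx => simp only [map_smul, hx]
  | hof a b p => rw [innerMap_ofPath, glueToGen_inner]; rfl

theorem glueToGen_outer {i j : V} (h : i ≠ j) (α : i ⟶ j) (a : S i) (b : S j) :
    glueToGen Ω (ofPath k (outerArrow h α a b).toPath) =
      glueIdem Ω (Glue.mk i a) * arrowIncl k (VertexAlgebra Ω) α * glueIdem Ω (Glue.mk j b) := by
  rw [glueToGen_ofPath]
  -- The value of a path with one arrow carries the idempotent of its start as an additional factor,
  -- which is absorbed.
  change glueIdem Ω (Glue.mk i a) * (glueIdem Ω (Glue.mk i a) * arrowIncl k (VertexAlgebra Ω) α *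
    glueIdem Ω (Glue.mk j b)) = _
  simp only [← mul_assoc, glueIdem_mul_self]

theorem glueToGen_eq_zero_of_mem_glueIdeal {x : PathAlgebra k (Glue S)} (hx : x ∈ glueIdeal Ω) :
    glueToGen Ω x = 0 := by
  refine span_le_of_map_eq_zero (glueToGen Ω).toRingHom ?_ hx
  rintro _ ⟨i, y, hy, rfl⟩
  change glueToGen Ω _ = 0
  rw [glueToGen_innerMap, (vertexProj_eq_zero_iff Ω i y).2 hy, map_zero]

/-- Each `γ` absorbs the idempotents contributed at its two ends by the neighbouring arrows, so only
those at the outer end points `a` and `b` survive. -/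
theorem glueToGen_toGluePath (hΓ : IsAcyclic V) {l l' : V} (d : DecoratedPath S l l') (a : S l)
    (b : S l') :
    glueToGen Ω (ofPath k (d.toGluePath hΓ a b)) =
      glueIdem Ω (Glue.mk l a) * ofAPath k (d.toAPath Ω) * glueIdem Ω (Glue.mk l' b) := by
  induction d with
  | single β => exact glueToGen_outer Ω (hΓ.ne β) β a b
  | @cons j l' d a' b' γ β ih =>
    rw [DecoratedPath.toGluePath_cons, ofPath_cons, ofPath_comp, map_mul, map_mul, ih, glueToGen_inner,
      glueToGen_outer, DecoratedPath.toAPath, ofAPath_cons, ofAPath_rmul]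
    change _ = _ * (_ * vertexPath Ω j γ * _ * vertexIncl k (VertexAlgebra Ω) l' 1) * _
    have h1 : glueIdem Ω (Glue.mk j a') * vertexPath Ω j γ = vertexPath Ω j γ := by
      rw [glueIdem_mk, ← vertexPath_comp, Quiver.Path.nil_comp]
    have h2 : vertexPath Ω j γ * glueIdem Ω (Glue.mk j b') = vertexPath Ω j γ := by
      exact (vertexPath_comp Ω j γ Quiver.Path.nil).symm
    simp only [mul_assoc]
    rw [← mul_assoc (glueIdem Ω (Glue.mk j a')), h1, ← mul_assoc (vertexPath Ω j γ) (glueIdem Ω _),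
      h2, ← mul_assoc (arrowIncl _ _ _) (vertexIncl _ _ _ _), arrowIncl_mul_one]

theorem glueToGen_inducedRelation (hΓ : IsAcyclic V) {l l' : V} (ρ : Quiver.Path l l' →₀ k)
    (d : Quiver.Path l l' → DecoratedPath S l l') (a : S l) (b : S l') :
    glueToGen Ω (∑ p ∈ ρ.support, ρ p • ofPath k ((d p).toGluePath hΓ a b)) =
      glueIdem Ω (Glue.mk l a) * (∑ p ∈ ρ.support, ρ p • ofAPath k ((d p).toAPath Ω)) *
        glueIdem Ω (Glue.mk l' b) := by
  simp only [map_sum, map_smul, glueToGen_toGluePath, Finset.mul_sum, Finset.sum_mul,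
    mul_smul_comm, smul_mul_assoc]

/-- The identities of `A_l` and `A_{l'}` fix the `𝒜`-path on the two sides, and each is the sum of
the idempotents at its vertices. -/
theorem ofAPath_eq_sum_glueIdem {l l' : V} (p : APath (VertexAlgebra Ω) l l') :
    ofAPath k p = ∑ a : S l, ∑ b : S l',
      glueIdem Ω (Glue.mk l a) * ofAPath k p * glueIdem Ω (Glue.mk l' b) := by
  simp only [← Finset.mul_sum, ← Finset.sum_mul, sum_glueIdem_vertex, one_mul_ofAPath,
    ofAPath_mul_one]

end GlueToGen

/-! ### From the generalized path algebra to quotients of the path algebra of `Γ[Σ₁, …, Σₙ]` -/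

section GenToGlue

variable {k : Type u₁} [Field k] {V : Type u} [Quiver.{v} V] {S : V → Type u₂}
  [∀ i, Quiver.{v₂} (S i)] [∀ i, Fintype (S i)] [Fintype V]
  (hΓ : IsAcyclic V) {Ω : ∀ i, TwoSidedIdeal (PathAlgebra k (S i))}
  {T : TwoSidedIdeal (PathAlgebra k (Glue S))} (hT : glueIdeal Ω ≤ T)

/-- The inclusion of `kΣᵢ` does not preserve `1` in general, so it is descended to `Aᵢ` as a linear
map only; multiplicativity is recovered in `vertexToGlue_mul`. The ideal `T` need only contain `(Ω₁,
…, Ωₙ)`; it is later taken to be `(Ω₁, …, Ωₙ) + L(I)`. -/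
theorem exists_vertexToGlue (hT : glueIdeal Ω ≤ T) (i : V) :
    ∃ ι : VertexAlgebra Ω i →ₗ[k] PathAlgebra k (Glue S) ⧸ T.asIdeal,
      ∀ x, ι (vertexProj Ω i x) = Ideal.Quotient.mkₐ k T.asIdeal (innerMap k S i x) := by
  refine exists_factor_of_surjective (vertexProj Ω i).toLinearMap (vertexProj_surjective Ω i)
    ((Ideal.Quotient.mkₐ k T.asIdeal).toLinearMap ∘ₗ innerMap k S i) fun x hx => ?_
  replace hx := (vertexProj_eq_zero_iff Ω i x).1 hx
  refine Ideal.Quotient.eq_zero_iff_mem.2 (TwoSidedIdeal.mem_asIdeal.2 (hT ?_))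
  exact TwoSidedIdeal.subset_span ⟨i, x, hx, rfl⟩

/-- The linear map `Aᵢ → kΓ[Σ₁, …, Σₙ] / T` induced by the inclusion of `Σᵢ`. -/
def vertexToGlue (i : V) : VertexAlgebra Ω i →ₗ[k] PathAlgebra k (Glue S) ⧸ T.asIdeal :=
  (exists_vertexToGlue hT i).choose

theorem vertexToGlue_proj (i : V) (x : PathAlgebra k (S i)) :
    vertexToGlue hT i (vertexProj Ω i x) = Ideal.Quotient.mkₐ k T.asIdeal (innerMap k S i x) :=
  (exists_vertexToGlue hT i).choose_spec x

theorem vertexToGlue_mul (i : V) (a b : VertexAlgebra Ω i) :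
    vertexToGlue hT i (a * b) = vertexToGlue hT i a * vertexToGlue hT i b := by
  obtain ⟨x, rfl⟩ := vertexProj_surjective Ω i a
  obtain ⟨y, rfl⟩ := vertexProj_surjective Ω i b
  rw [← map_mul, vertexToGlue_proj, vertexToGlue_proj, vertexToGlue_proj, innerMap_mul, map_mul]

theorem vertexToGlue_one (i : V) : vertexToGlue hT i 1 = Ideal.Quotient.mkₐ k T.asIdeal
    (∑ a : S i, ofPath k (Quiver.Path.nil : Quiver.Path (Glue.mk i a) (Glue.mk i a))) := by
  rw [← map_one (vertexProj Ω i), vertexToGlue_proj, one_eq_sum_ofPath_nil, map_sum]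
  simp only [innerMap_ofPath]
  rfl

theorem sum_vertexToGlue_one : ∑ i, vertexToGlue hT i 1 = 1 := by
  simp only [vertexToGlue_one]
  rw [← map_sum, ← map_one (Ideal.Quotient.mkₐ k T.asIdeal), one_eq_sum_ofPath_nil (Q := Glue S),
    sum_glue]

theorem vertexToGlue_one_mul_of_ne (i j : V) (h : i ≠ j) :
    vertexToGlue hT i 1 * vertexToGlue hT j 1 = 0 := by
  rw [vertexToGlue_one, vertexToGlue_one, ← map_mul, Finset.sum_mul_sum]
  have : ∀ (a : S i) (b : S j), ofPath k (Quiver.Path.nil : Quiver.Path (Glue.mk i a) (Glue.mk i a))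
      * ofPath k (Quiver.Path.nil : Quiver.Path (Glue.mk j b) (Glue.mk j b)) = 0 := fun a b =>
    ofPath_mul_of_ne (fun e : Glue.mk (S := S) i a = Glue.mk j b => h (Sigma.mk.inj e).1) _ _
  simp only [this, Finset.sum_const_zero, map_zero]

/-- The sum of the arrows `α_{a,b}` over all vertices `a` and `b`. -/
def outerSum (k : Type u₁) [Field k] (S : V → Type u₂) [∀ i, Quiver.{v₂} (S i)]
    [∀ i, Fintype (S i)] (hΓ : IsAcyclic V) (i j : V) (α : i ⟶ j) : PathAlgebra k (Glue S) :=
  ∑ a : S i, ∑ b : S j,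
    ofPath k (outerArrow (hΓ.ne α) α a b).toPath

/-- The homomorphism `k(Γ, 𝒜) → kΓ[Σ₁, …, Σₙ] / T`. -/
def genToGlue : GenPathAlgebra k (VertexAlgebra Ω) →ₐ[k] PathAlgebra k (Glue S) ⧸ T.asIdeal :=
  genPathAlgebraLift (vertexToGlue hT)
    (fun i j α => Ideal.Quotient.mkₐ k T.asIdeal (outerSum k S hΓ i j α))
    (sum_vertexToGlue_one hT) (vertexToGlue_mul hT) (vertexToGlue_one_mul_of_ne hT)

theorem genToGlue_vertexIncl (i : V) (x : PathAlgebra k (S i)) :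
    genToGlue hΓ hT (vertexIncl k (VertexAlgebra Ω) i (vertexProj Ω i x)) =
      Ideal.Quotient.mkₐ k T.asIdeal (innerMap k S i x) := by
  rw [← vertexToGlue_proj hT]
  exact genPathAlgebraLift_ofAPath _ _ _ _

theorem genToGlue_arrowIncl {i j : V} (α : i ⟶ j) :
    genToGlue hΓ hT (arrowIncl k (VertexAlgebra Ω) α) =
      vertexToGlue hT i 1 * Ideal.Quotient.mkₐ k T.asIdeal (outerSum k S hΓ i j α) *
        vertexToGlue hT j 1 :=
  genPathAlgebraLift_ofAPath _ _ _ _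

theorem genToGlue_glueIdem (x : Glue S) :
    genToGlue hΓ hT (glueIdem Ω x) =
      Ideal.Quotient.mkₐ k T.asIdeal (ofPath k (Quiver.Path.nil : Quiver.Path x x)) := by
  rw [glueIdem, vertexPath, genToGlue_vertexIncl, innerMap_ofPath]
  rfl

/-- Cutting with the two trivial paths kills every summand with a different start or end. This is
why sending `α` to the whole sum loses no information. -/
theorem nil_mul_outerSum_mul_nil {i j : V} (α : i ⟶ j) (a : S i) (b : S j) :
    ofPath k (Quiver.Path.nil : Quiver.Path (Glue.mk i a) (Glue.mk i a)) * outerSum k S hΓ i j α *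
      ofPath k (Quiver.Path.nil : Quiver.Path (Glue.mk j b) (Glue.mk j b)) =
    ofPath k (outerArrow (hΓ.ne α) α a b).toPath := by
  have inj : ∀ {i : V} {a b : S i}, Glue.mk i a = Glue.mk i b → a = b :=
    fun h => eq_of_heq (Sigma.mk.inj h).2
  simp only [outerSum, Finset.mul_sum, Finset.sum_mul]
  rw [Finset.sum_eq_single a, Finset.sum_eq_single b]
  · rw [← ofPath_comp, ← ofPath_comp, Quiver.Path.nil_comp, Quiver.Path.comp_nil]
  · intro b' _ hb
    rw [mul_assoc, ofPath_mul_of_ne (fun h => hb (inj h)), mul_zero]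
  · simp
  · intro a' _ ha
    refine Finset.sum_eq_zero fun b' _ => ?_
    rw [ofPath_mul_of_ne (fun h => ha (inj h).symm), zero_mul]
  · simp

theorem genToGlue_comp_glueToGen :
    (genToGlue hΓ hT).comp (glueToGen Ω) = Ideal.Quotient.mkₐ k T.asIdeal := by
  refine PathSpan.algHom_ext fun x y p => ?_
  change genToGlue hΓ hT (glueToGen Ω (ofPath k p)) = _
  induction p with
  | nil =>
    rw [glueToGen_ofPath]
    exact genToGlue_glueIdem hΓ hT x
  | @cons y z p f ih =>
    have key : genToGlue hΓ hT (glueToGen Ω (ofPath k f.toPath)) =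
        Ideal.Quotient.mkₐ k T.asIdeal (ofPath k f.toPath) := by
      induction f using Glue.hom_cases with
      | inner f =>
        have := glueToGen_innerMap Ω (ofPath k f.toPath)
        rw [innerMap_ofPath] at this
        refine (congrArg (genToGlue hΓ hT) this).trans ?_
        rw [genToGlue_vertexIncl, innerMap_ofPath]
        rfl
      | @outer i j h α a b =>
        rw [glueToGen_outer, ← nil_mul_outerSum_mul_nil hΓ α a b]
        simp only [map_mul, genToGlue_arrowIncl, genToGlue_glueIdem]
        -- As an `𝒜`-path the arrow `α` is `1 α 1`, so its image carries the images of the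
        -- identities of `Aᵢ` and `Aⱼ`. The trivial paths at `a` and `b` absorb them.
        have hl : Ideal.Quotient.mkₐ k T.asIdeal
            (ofPath k (Quiver.Path.nil : Quiver.Path (Glue.mk i a) (Glue.mk i a))) *
              vertexToGlue hT i 1 = Ideal.Quotient.mkₐ k T.asIdeal
            (ofPath k (Quiver.Path.nil : Quiver.Path (Glue.mk i a) (Glue.mk i a))) := by
          have := vertexToGlue_proj hT i (ofPath k (Quiver.Path.nil : Quiver.Path a a))
          rw [innerMap_ofPath] at this
          refine Eq.trans ?_ this
          rw [← mul_one (vertexProj Ω i _), vertexToGlue_mul, this]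
          rfl
        have hr : vertexToGlue hT j 1 * Ideal.Quotient.mkₐ k T.asIdeal
            (ofPath k (Quiver.Path.nil : Quiver.Path (Glue.mk j b) (Glue.mk j b))) =
              Ideal.Quotient.mkₐ k T.asIdeal
            (ofPath k (Quiver.Path.nil : Quiver.Path (Glue.mk j b) (Glue.mk j b))) := by
          have := vertexToGlue_proj hT j (ofPath k (Quiver.Path.nil : Quiver.Path b b))
          rw [innerMap_ofPath] at this
          refine Eq.trans ?_ this
          rw [← one_mul (vertexProj Ω j _), vertexToGlue_mul, this]
          rfl
        rw [mul_assoc, mul_assoc, mul_assoc, hr, ← mul_assoc, ← mul_assoc, hl, mul_assoc]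
    change genToGlue hΓ hT (glueToGen Ω (ofPath k (p.cons f))) =
      Ideal.Quotient.mkₐ k T.asIdeal (ofPath k (p.cons f))
    rw [ofPath_cons, map_mul, map_mul, map_mul, ih, key]

theorem genToGlue_glueToGen (x : PathAlgebra k (Glue S)) :
    genToGlue hΓ hT (glueToGen Ω x) = Ideal.Quotient.mkₐ k T.asIdeal x :=
  DFunLike.congr_fun (genToGlue_comp_glueToGen hΓ hT) x

theorem glueToGen_outerSum {i j : V} (α : i ⟶ j) :
    glueToGen Ω (outerSum k S hΓ i j α) = arrowIncl k (VertexAlgebra Ω) α := by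
  simp only [outerSum, map_sum, glueToGen_outer]
  exact (ofAPath_eq_sum_glueIdem Ω _).symm

/-- Yields the remaining composite of the isomorphism, with `φ` the projection to `k(Γ, 𝒜, I)` and
`θ` the map induced by `glueToGen`. It suffices to compare on vertex algebras and arrows, which
`glueToGen` hits explicitly. -/
theorem comp_genToGlue {R : Type*} [Ring R] [Algebra k R]
    (φ : GenPathAlgebra k (VertexAlgebra Ω) →ₐ[k] R)
    (θ : PathAlgebra k (Glue S) ⧸ T.asIdeal →ₐ[k] R)
    (h : ∀ x, θ (Ideal.Quotient.mkₐ k T.asIdeal x) = φ (glueToGen Ω x)) :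
    θ.comp (genToGlue hΓ hT) = φ := by
  have hv : ∀ i (a : VertexAlgebra Ω i), θ (vertexToGlue hT i a) = φ (vertexIncl k _ i a) := by
    intro i a
    obtain ⟨x, rfl⟩ := vertexProj_surjective Ω i a
    rw [vertexToGlue_proj, h, glueToGen_innerMap]
  refine GenPathAlgebra.algHom_ext (fun i a => ?_) (fun i j α => ?_)
  · obtain ⟨x, rfl⟩ := vertexProj_surjective Ω i a
    rw [AlgHom.comp_apply, genToGlue_vertexIncl, h, glueToGen_innerMap]
  · rw [AlgHom.comp_apply, genToGlue_arrowIncl, map_mul, map_mul, hv, hv, h, glueToGen_outerSum,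
      ← map_mul, ← map_mul, one_mul_arrowIncl, arrowIncl_mul_one]

end GenToGlue

/-! ### The isomorphism -/

section Iso

variable {k : Type u₁} [Field k] {V : Type u} [Quiver.{v} V] {S : V → Type u₂}
  [∀ i, Quiver.{v₂} (S i)] [∀ i, Fintype (S i)] [Fintype V]
  (hΓ : IsAcyclic V) (Ω : ∀ i, TwoSidedIdeal (PathAlgebra k (S i))) (I : Set (PathAlgebra k V))

/-- The projection `k(Γ, 𝒜) → k(Γ, 𝒜, I)`. -/
def gbpProj : GenPathAlgebra k (VertexAlgebra Ω) →ₐ[k] GBPAlgebra Ω I :=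
  Ideal.Quotient.mkₐ k (TwoSidedIdeal.span (inducedARelations Ω I)).asIdeal

theorem gbpProj_eq_zero {x : GenPathAlgebra k (VertexAlgebra Ω)} (hx : x ∈ inducedARelations Ω I) :
    gbpProj Ω I x = 0 :=
  Ideal.Quotient.eq_zero_iff_mem.2 (TwoSidedIdeal.mem_asIdeal.2 (TwoSidedIdeal.subset_span hx))

theorem gbpProj_glueToGen_eq_zero {x : PathAlgebra k (Glue S)}
    (hx : x ∈ glueIdeal Ω ⊔ inducedIdeal hΓ S I) : gbpProj Ω I (glueToGen Ω x) = 0 := by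
  refine sup_map_eq_zero ((gbpProj Ω I).comp (glueToGen Ω)).toRingHom (fun y hy => ?_)
    (fun y hy => ?_) hx
  · change gbpProj Ω I (glueToGen Ω y) = 0
    rw [glueToGen_eq_zero_of_mem_glueIdeal Ω hy, map_zero]
  · refine span_le_of_map_eq_zero _ ?_ hy
    rintro _ ⟨l, l', ρ, d, a, b, hρ, hd, rfl⟩
    change gbpProj Ω I (glueToGen Ω _) = 0
    -- The image is `e_a r e_b` with `r ∈ 𝒜(I)`.
    rw [glueToGen_inducedRelation, map_mul, map_mul,
      gbpProj_eq_zero Ω I ⟨l, l', ρ, d, hρ, hd, rfl⟩, mul_zero, zero_mul]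

/-- The homomorphism `kΓ[Σ₁, …, Σₙ] / ((Ω₁, …, Ωₙ) + L(I)) → k(Γ, 𝒜, I)`. -/
def glueQuotientToGBP :
    PathAlgebra k (Glue S) ⧸ (glueIdeal Ω ⊔ inducedIdeal hΓ S I).asIdeal →ₐ[k] GBPAlgebra Ω I :=
  Ideal.Quotient.liftₐ _ ((gbpProj Ω I).comp (glueToGen Ω)) fun _ hx =>
    gbpProj_glueToGen_eq_zero hΓ Ω I (TwoSidedIdeal.mem_asIdeal.1 hx)

theorem genToGlue_inducedARelation {x : GenPathAlgebra k (VertexAlgebra Ω)}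
    (hx : x ∈ inducedARelations Ω I) :
    genToGlue (T := glueIdeal Ω ⊔ inducedIdeal hΓ S I) hΓ le_sup_left x = 0 := by
  obtain ⟨l, l', ρ, d, hρ, hd, rfl⟩ := hx
  -- An element of `𝒜(I)` is the sum, over all choices of end points, of the images of the
  -- corresponding elements of `R(I)`.
  have e : ∑ p ∈ ρ.support, ρ p • ofAPath k ((d p).toAPath Ω) = ∑ a : S l, ∑ b : S l',
      glueToGen Ω (∑ p ∈ ρ.support, ρ p • ofPath k ((d p).toGluePath hΓ a b)) := by
    simp only [glueToGen_inducedRelation, ← Finset.mul_sum, ← Finset.sum_mul, sum_glueIdem_vertex]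
    simp only [Finset.mul_sum, Finset.sum_mul, mul_smul_comm, smul_mul_assoc, one_mul_ofAPath,
      ofAPath_mul_one]
  rw [e]
  simp only [map_sum, genToGlue_glueToGen]
  simp only [← map_sum]
  refine Ideal.Quotient.eq_zero_iff_mem.2 (Ideal.sum_mem _ fun a _ => Ideal.sum_mem _ fun b _ => ?_)
  refine TwoSidedIdeal.mem_asIdeal.2 ((le_sup_right : inducedIdeal hΓ S I ≤ _) ?_)
  exact TwoSidedIdeal.subset_span ⟨l, l', ρ, d, a, b, hρ, hd, rfl⟩

/-- The homomorphism `k(Γ, 𝒜, I) → kΓ[Σ₁, …, Σₙ] / ((Ω₁, …, Ωₙ) + L(I))`. -/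
def gbpToGlueQuotient :
    GBPAlgebra Ω I →ₐ[k] PathAlgebra k (Glue S) ⧸ (glueIdeal Ω ⊔ inducedIdeal hΓ S I).asIdeal :=
  Ideal.Quotient.liftₐ (TwoSidedIdeal.span (inducedARelations Ω I)).asIdeal
    (genToGlue hΓ le_sup_left) fun _ hx =>
      span_le_of_map_eq_zero (genToGlue hΓ le_sup_left).toRingHom
        (fun _ hy => genToGlue_inducedARelation hΓ Ω I hy) (TwoSidedIdeal.mem_asIdeal.1 hx)

/-- The isomorphism `kΓ[Σ₁, …, Σₙ] / ((Ω₁, …, Ωₙ) + L(I)) ≃ k(Γ, 𝒜, I)`. -/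
def glueQuotientEquivGBP :
    (PathAlgebra k (Glue S) ⧸ (glueIdeal Ω ⊔ inducedIdeal hΓ S I).asIdeal) ≃ₐ[k] GBPAlgebra Ω I :=
  AlgEquiv.ofAlgHom (glueQuotientToGBP hΓ Ω I) (gbpToGlueQuotient hΓ Ω I)
    (Ideal.Quotient.algHom_ext k
      (comp_genToGlue hΓ le_sup_left (gbpProj Ω I) (glueQuotientToGBP hΓ Ω I) fun _ => rfl))
    (Ideal.Quotient.algHom_ext k (genToGlue_comp_glueToGen hΓ le_sup_left))

end Iso

/-! ### Powers of the arrow ideal -/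

section ArrowIdeal

variable {k : Type u₁} [Field k] {Q : Type u} [Quiver.{v} Q]

/-- The subspace of a path algebra spanned by the paths of length at least `n`. -/
def longPaths (k : Type u₁) [Field k] (Q : Type u) [Quiver.{v} Q] (n : ℕ) :
    Submodule k (PathAlgebra k Q) :=
  Submodule.span k {x | ∃ (a b : Q) (p : Quiver.Path a b), n ≤ p.length ∧ x = ofPath k p}

theorem ofPath_mem_longPaths {n : ℕ} {a b : Q} (p : Quiver.Path a b) (h : n ≤ p.length) :
    ofPath k p ∈ longPaths k Q n :=
  Submodule.subset_span ⟨a, b, p, h, rfl⟩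

theorem mem_longPaths_zero (x : PathAlgebra k Q) : x ∈ longPaths k Q 0 := by
  induction x using PathSpan.induct with
  | hof i j p => exact ofPath_mem_longPaths p (Nat.zero_le _)
  | h0 => exact zero_mem _
  | hadd x y hx hy => exact add_mem hx hy
  | hsmul c x hx => exact Submodule.smul_mem _ c hx

theorem coeff_eq_zero_of_mem_longPaths {n : ℕ} {x : PathAlgebra k Q} (hx : x ∈ longPaths k Q n)
    {a b : Q} (p : Quiver.Path a b) (hp : p.length < n) :
    Finsupp.lapply (R := k) (M := k) (⟨a, b, p⟩ : Σ a b : Q, Quiver.Path a b) x = 0 := by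
  induction hx using Submodule.span_induction with
  | zero => exact map_zero _
  | add x y _ _ h₁ h₂ => exact (map_add _ x y).trans ((congrArg₂ (· + ·) h₁ h₂).trans (add_zero 0))
  | smul c x _ h => exact (map_smul _ c x).trans ((congrArg (c • ·) h).trans (smul_zero c))
  | mem x h =>
    obtain ⟨a', b', q, hq, rfl⟩ := h
    refine Finsupp.single_eq_of_ne ?_
    intro e
    have : p.length = q.length := congrArg (fun s : Σ a b : Q, Quiver.Path a b => s.2.2.length) e
    omega

theorem coeff_combination {a b : Q} (ρ : Quiver.Path a b →₀ k) (p : Quiver.Path a b) :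
    Finsupp.lapply (R := k) (M := k) (⟨a, b, p⟩ : Σ a b : Q, Quiver.Path a b) (combination ρ) =
      ρ p := by
  classical
  unfold combination Finsupp.sum
  refine (map_sum (Finsupp.lapply (R := k) (M := k) (⟨a, b, p⟩ : Σ a b : Q, Quiver.Path a b))
    _ _).trans ?_
  have : ∀ q : Quiver.Path a b,
      Finsupp.lapply (R := k) (M := k) (⟨a, b, p⟩ : Σ a b : Q, Quiver.Path a b)
        (ρ q • ofPath k q) = if q = p then ρ p else 0 := by
    intro q
    refine (map_smul (Finsupp.lapply (R := k) (M := k) _) (ρ q) (ofPath k q)).trans ?_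
    by_cases e : q = p
    · subst e
      rw [if_pos rfl]
      exact (congrArg (ρ q • ·) Finsupp.single_eq_same).trans (mul_one _)
    · rw [if_neg e]
      refine (congrArg (ρ q • ·) (Finsupp.single_eq_of_ne ?_)).trans (smul_zero _)
      intro h
      simp only [Sigma.mk.injEq, heq_eq_eq, true_and] at h
      exact e h.symm
  simp only [this]
  rw [Finset.sum_ite_eq']
  split_ifs with h
  · rfl
  · exact (Finsupp.notMem_support_iff.1 h).symm

variable [Fintype Q]

theorem mul_mem_longPaths {m n : ℕ} {x y : PathAlgebra k Q} (hx : x ∈ longPaths k Q m)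
    (hy : y ∈ longPaths k Q n) : x * y ∈ longPaths k Q (m + n) := by
  induction hx using Submodule.span_induction with
  | zero => rw [zero_mul]; exact zero_mem _
  | add x₁ x₂ _ _ h₁ h₂ => rw [add_mul]; exact add_mem h₁ h₂
  | smul c x _ h => rw [smul_mul_assoc]; exact Submodule.smul_mem _ c h
  | mem x h =>
    obtain ⟨a, b, p, hp, rfl⟩ := h
    induction hy using Submodule.span_induction with
    | zero => rw [mul_zero]; exact zero_mem _
    | add x₁ x₂ _ _ h₁ h₂ => rw [mul_add]; exact add_mem h₁ h₂
    | smul c x _ h => rw [mul_smul_comm]; exact Submodule.smul_mem _ c h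
    | mem y h =>
      obtain ⟨b', c, q, hq, rfl⟩ := h
      by_cases e : b = b'
      · subst e
        rw [← ofPath_comp]
        exact ofPath_mem_longPaths _ (by rw [Quiver.Path.length_comp]; omega)
      · rw [ofPath_mul_of_ne e]
        exact zero_mem _

/-- The span of the paths of positive length is itself a two-sided ideal and contains the arrows. -/
theorem mem_longPaths_one_of_mem_arrowIdeal {x : PathAlgebra k Q} (hx : x ∈ arrowIdeal k Q) :
    x ∈ longPaths k Q 1 := by
  let K : TwoSidedIdeal (PathAlgebra k Q) :=
    TwoSidedIdeal.mk' (longPaths k Q 1 : Set (PathAlgebra k Q))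
      (zero_mem _) (fun hx hy => add_mem hx hy) (fun hx => neg_mem hx)
      (fun {x y} hy => by simpa using mul_mem_longPaths (mem_longPaths_zero x) hy)
      (fun {x y} hx => by simpa using mul_mem_longPaths hx (mem_longPaths_zero y))
  have hK : arrowIdeal k Q ≤ K := by
    refine TwoSidedIdeal.span_le.2 ?_
    rintro _ ⟨a, b, α, rfl⟩
    exact (TwoSidedIdeal.mem_mk' _ _ _ _ _ _ _).2 (ofPath_mem_longPaths _ le_rfl)
  exact (TwoSidedIdeal.mem_mk' _ _ _ _ _ _ _).1 (hK hx)

/-- Together with `ofPath_mem_pow` this identifies `Jⁿ` with the span of the paths of length at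
least `n`, so that admissibility becomes a matter of path lengths. -/
theorem mem_longPaths_of_mem_pow {n : ℕ} {x : PathAlgebra k Q}
    (hx : x ∈ (arrowIdeal k Q).asIdeal ^ n) : x ∈ longPaths k Q n := by
  induction n generalizing x with
  | zero => exact mem_longPaths_zero x
  | succ n ih =>
    rw [Submodule.pow_succ] at hx
    refine Submodule.smul_induction_on hx (fun r hr s hs => ?_) (fun _ _ h₁ h₂ => add_mem h₁ h₂)
    exact mul_mem_longPaths (ih hr)
      (mem_longPaths_one_of_mem_arrowIdeal (TwoSidedIdeal.mem_asIdeal.1 hs))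

theorem mem_pow_zero {R : Type*} [Ring R] (K : Ideal R) {x : R} : x ∈ K ^ 0 := by
  rw [Submodule.pow_zero, Ideal.one_eq_top]
  trivial

theorem ofPath_mem_pow {n : ℕ} {a b : Q} (p : Quiver.Path a b) (hp : n ≤ p.length) :
    ofPath k p ∈ (arrowIdeal k Q).asIdeal ^ n := by
  induction p generalizing n with
  | nil =>
    obtain rfl : n = 0 := Nat.le_zero.1 hp
    exact mem_pow_zero _
  | cons p f ih =>
    cases n with
    | zero => exact mem_pow_zero _
    | succ n =>
      rw [ofPath_cons, Submodule.pow_succ]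
      exact Ideal.mul_mem_mul (ih (Nat.le_of_succ_le_succ hp))
        (TwoSidedIdeal.mem_asIdeal.2 (TwoSidedIdeal.subset_span ⟨_, _, f, rfl⟩))

theorem smul_mem_leftIdeal (K : Ideal (PathAlgebra k Q)) (c : k) {x : PathAlgebra k Q}
    (hx : x ∈ K) : c • x ∈ K := by
  rw [Algebra.smul_def]
  exact K.mul_mem_left _ hx

theorem longPaths_le {n : ℕ} (K : Ideal (PathAlgebra k Q))
    (h : ∀ (a b : Q) (p : Quiver.Path a b), n ≤ p.length → ofPath k p ∈ K)
    {x : PathAlgebra k Q} (hx : x ∈ longPaths k Q n) : x ∈ K := by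
  induction hx using Submodule.span_induction with
  | zero => exact zero_mem _
  | add x₁ x₂ _ _ h₁ h₂ => exact add_mem h₁ h₂
  | smul c x _ h => exact smul_mem_leftIdeal K c h
  | mem x hx =>
    obtain ⟨a, b, p, hp, rfl⟩ := hx
    exact h a b p hp

/-- Elements of `J²` have coefficient zero at every path of length less than two, whereas the
coefficient at `p` is `ρ p ≠ 0`. -/
theorem two_le_length_of_combination_mem {J : TwoSidedIdeal (PathAlgebra k Q)}
    (hJ : IsAdmissible J) {a b : Q} {ρ : Quiver.Path a b →₀ k} (hρ : combination ρ ∈ J)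
    {p : Quiver.Path a b} (hp : p ∈ ρ.support) : 2 ≤ p.length := by
  obtain ⟨_, _, _, h⟩ := hJ
  by_contra hlt
  refine Finsupp.mem_support_iff.1 hp ?_
  rw [← coeff_combination]
  exact coeff_eq_zero_of_mem_longPaths
    (mem_longPaths_of_mem_pow (h (TwoSidedIdeal.mem_asIdeal.2 hρ))) p (by omega)

end ArrowIdeal

/-! ### Admissibility -/

section Admissible

/-- The number of vertices from which `v` can be reached. -/
def predCount {V : Type u} [Quiver.{v} V] (i : V) : ℕ :=
  Set.ncard {j : V | Nonempty (Quiver.Path j i)}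

/-- Whatever reaches `i` reaches `j` through `α`. The vertex `j` reaches itself but not `i`, since a
path from `j` to `i` followed by `α` would be a cycle. -/
theorem predCount_lt {V : Type u} [Quiver.{v} V] [Finite V] (hΓ : IsAcyclic V) {i j : V}
    (α : i ⟶ j) : predCount i < predCount j := by
  refine Set.ncard_lt_ncard ⟨fun l ⟨p⟩ => ⟨p.cons α⟩, fun h => ?_⟩ (Set.toFinite _)
  obtain ⟨p⟩ := h (show j ∈ {l : V | Nonempty (Quiver.Path l j)} from ⟨Quiver.Path.nil⟩)
  simpa using hΓ j (p.cons α)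

theorem predCount_le {V : Type u} [Quiver.{v} V] [Finite V] (i : V) : predCount i ≤ Nat.card V := by
  rw [← Set.ncard_univ]
  exact Set.ncard_le_ncard (Set.subset_univ _) (Set.toFinite _)

variable {k : Type u₁} [Field k] {V : Type u} [Quiver.{v} V] {S : V → Type u₂}
  [∀ i, Quiver.{v₂} (S i)]

theorem length_comp_innerPath_cons {x z : Glue S} {i : V} {a b : S i}
    (q : Quiver.Path x (Glue.mk i a)) (γ : Quiver.Path a b) (f : Glue.mk i b ⟶ z) :
    ((q.comp (innerPath γ)).cons f).length = q.length + γ.length + 1 := by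
  rw [Quiver.Path.length_cons, Quiver.Path.length_comp, length_innerPath]

theorem DecoratedPath.length_le_length_toGluePath (hΓ : IsAcyclic V) {i j : V}
    (d : DecoratedPath S i j) (x : S i) (y : S j) :
    d.underlying.length ≤ (d.toGluePath hΓ x y).length := by
  induction d with
  | single β => exact le_rfl
  | @cons j l d a b γ β ih =>
    have := ih a
    rw [toGluePath_cons, underlying, Quiver.Path.length_cons, Quiver.Path.length_cons,
      Quiver.Path.length_comp]
    omega

variable [Fintype V] [∀ i, Fintype (S i)] (Ω : ∀ i, TwoSidedIdeal (PathAlgebra k (S i)))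

/-- Here `γ` is the current run inside the last `Σ`, and `q` is everything before it. When an arrow
`α_{a,b}` closes the run, `q` grows by `γ.length + 1 ≤ M`, while `predCount` grows by at least one;
this keeps the bound on `q`. A run that reaches length `M` puts the whole path in the ideal. -/
theorem ofPath_mem_glueIdeal_or_exists_comp (hΓ : IsAcyclic V) {M : ℕ}
    (hM : ∀ (i : V) (a b : S i) (p : Quiver.Path a b), M ≤ p.length → ofPath k p ∈ Ω i)
    (hM0 : 0 < M) {x y : Glue S} (p : Quiver.Path x y) :
    ofPath k p ∈ glueIdeal Ω ∨
      ∃ (c : S y.1) (q : Quiver.Path x (Glue.mk y.1 c)) (γ : Quiver.Path c y.2),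
        p = q.comp (innerPath γ) ∧ q.length ≤ M * predCount y.1 ∧ γ.length < M := by
  induction p with
  | nil => exact Or.inr ⟨x.2, Quiver.Path.nil, Quiver.Path.nil, rfl, Nat.zero_le _, hM0⟩
  | @cons y z p f ih =>
    rcases ih with h | ⟨c, q, γ, rfl, hq, hγ⟩
    · left
      rw [ofPath_cons]
      exact (glueIdeal Ω).mul_mem_right _ _ h
    · induction f using Glue.hom_cases with
      | @inner i a b f =>
        by_cases hlt : (γ.cons f).length < M
        · exact Or.inr ⟨c, q, γ.cons f, rfl, hq, hlt⟩
        · left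
          have h : ofPath k (γ.cons f) ∈ Ω i := hM i _ _ _ (not_lt.1 hlt)
          have h' : ofPath k (innerPath (γ.cons f)) ∈ glueIdeal Ω :=
            TwoSidedIdeal.subset_span ⟨i, _, h, (innerMap_ofPath _).symm⟩
          have := (glueIdeal Ω).mul_mem_left (ofPath k q) _ h'
          rwa [← ofPath_comp] at this
      | @outer i j h α a b =>
        -- The closed run and the arrow are moved into `q`, and a new empty run starts at `b`.
        refine Or.inr ⟨b, _, Quiver.Path.nil, rfl, ?_, hM0⟩
        have h1 : predCount i + 1 ≤ predCount j := predCount_lt hΓ α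
        have h2 : M * (predCount i + 1) ≤ M * predCount j := Nat.mul_le_mul_left M h1
        have h3 : q.length ≤ M * predCount i := hq
        rw [mul_add] at h2
        refine (length_comp_innerPath_cons (i := i) q γ _).trans_le ?_
        change q.length + γ.length + 1 ≤ M * predCount j
        omega

theorem exists_pow_arrowIdeal_le_glueIdeal (hΓ : IsAcyclic V) (hΩ : ∀ i, IsAdmissible (Ω i)) :
    ∃ n, 2 ≤ n ∧ (arrowIdeal k (Glue S)).asIdeal ^ n ≤ (glueIdeal Ω).asIdeal := by
  choose m hm hle _ using hΩ
  -- The sum bounds every `m i` at once; the added one keeps `M` positive even if `Γ` has no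
  -- vertices.
  set M := (∑ i, m i) + 1 with hMdef
  have hM : ∀ (i : V) (a b : S i) (p : Quiver.Path a b), M ≤ p.length → ofPath k p ∈ Ω i := by
    intro i a b p hp
    have : m i ≤ ∑ i, m i := Finset.single_le_sum (fun _ _ => Nat.zero_le _) (Finset.mem_univ i)
    exact TwoSidedIdeal.mem_asIdeal.1 (hle i (ofPath_mem_pow p (by omega)))
  -- A path outside the ideal has length less than `M * Nat.card V + M`: at most `M * Nat.card V`
  -- for `q`, and less than `M` for the last run. The summand `2` ensures `2 ≤ n`.
  refine ⟨M * Nat.card V + M + 2, by omega, fun x hx => ?_⟩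
  refine longPaths_le _ (fun a b p hp => ?_) (mem_longPaths_of_mem_pow hx)
  rcases ofPath_mem_glueIdeal_or_exists_comp Ω hΓ hM (by omega) p with h | ⟨c, q, γ, rfl, hq, hγ⟩
  · exact TwoSidedIdeal.mem_asIdeal.2 h
  · exfalso
    have h2 : M * predCount b.1 ≤ M * Nat.card V := Nat.mul_le_mul_left M (predCount_le b.1)
    have h3 : (q.comp (innerPath γ)).length = q.length + γ.length := by
      rw [Quiver.Path.length_comp, length_innerPath]
    exact absurd (hp.trans_eq h3) (by omega)

theorem innerMap_mem_arrowIdeal_pow {i : V} {n : ℕ} {x : PathAlgebra k (S i)}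
    (hx : x ∈ (arrowIdeal k (S i)).asIdeal ^ n) :
    innerMap k S i x ∈ (arrowIdeal k (Glue S)).asIdeal ^ n := by
  replace hx := mem_longPaths_of_mem_pow hx
  induction hx using Submodule.span_induction with
  | zero => rw [map_zero]; exact zero_mem _
  | add x₁ x₂ _ _ h₁ h₂ => rw [map_add]; exact add_mem h₁ h₂
  | smul c x _ h => rw [map_smul]; exact smul_mem_leftIdeal _ c h
  | mem x h =>
    obtain ⟨a, b, p, hp, rfl⟩ := h
    rw [innerMap_ofPath]
    exact ofPath_mem_pow _ (by rwa [length_innerPath])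

theorem isAdmissible_glueIdeal_sup_inducedIdeal (hΓ : IsAcyclic V)
    (hΩ : ∀ i, IsAdmissible (Ω i)) (I : Set (PathAlgebra k V))
    (hI : IsAdmissible (TwoSidedIdeal.span I)) :
    IsAdmissible (glueIdeal Ω ⊔ inducedIdeal hΓ S I) := by
  obtain ⟨n, hn, hle⟩ := exists_pow_arrowIdeal_le_glueIdeal Ω hΓ hΩ
  refine ⟨n, hn, fun x hx => ?_, ?_⟩
  · exact TwoSidedIdeal.mem_asIdeal.2
      ((le_sup_left : glueIdeal Ω ≤ _) (TwoSidedIdeal.mem_asIdeal.1 (hle hx)))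
  -- With `J²` regarded as a two-sided ideal, only the generators of the two summands have to be
  -- checked.
  · have h : glueIdeal Ω ⊔ inducedIdeal hΓ S I ≤
        ((arrowIdeal k (Glue S)).asIdeal ^ 2).toTwoSided := by
      refine sup_le (TwoSidedIdeal.span_le.2 ?_) (TwoSidedIdeal.span_le.2 ?_)
      · rintro _ ⟨i, y, hy, rfl⟩
        obtain ⟨_, _, _, h⟩ := hΩ i
        exact Ideal.mem_toTwoSided.2
          (innerMap_mem_arrowIdeal_pow (h (TwoSidedIdeal.mem_asIdeal.2 hy)))
      · rintro _ ⟨l, l', ρ, d, a, b, hρ, hd, rfl⟩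
        refine Ideal.mem_toTwoSided.2 (Ideal.sum_mem _ fun p hp => ?_)
        refine smul_mem_leftIdeal _ _ (ofPath_mem_pow _ ?_)
        have h2 := two_le_length_of_combination_mem hI (TwoSidedIdeal.subset_span hρ) hp
        have h3 := (d p).length_le_length_toGluePath hΓ a b
        rw [hd p hp] at h3
        exact h2.trans h3
    exact fun x hx => Ideal.mem_toTwoSided.1 (h (TwoSidedIdeal.mem_asIdeal.1 hx))

end Admissible

end GBP

end

/-! ### The main theorem -/

theorem mainTheorem1 {k : Type*} [Field k]
    {V : Type*} [Quiver V] [Fintype V] [∀ i j : V, Finite (i ⟶ j)]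
    (hΓ : GBP.IsAcyclic V)
    (S : V → Type*) [∀ i, Quiver (S i)] [∀ i, Fintype (S i)]
    [∀ (i : V) (a b : S i), Finite (a ⟶ b)]
    (Ω : ∀ i, TwoSidedIdeal (GBP.PathAlgebra k (S i)))
    (hΩ : ∀ i, GBP.IsAdmissible (Ω i))
    (I : Set (GBP.PathAlgebra k V))
    (hI : ∀ r ∈ I, GBP.IsRelation r)
    (hIadm : GBP.IsAdmissible (TwoSidedIdeal.span I)) :
    GBP.IsAdmissible (GBP.glueIdeal Ω ⊔ GBP.inducedIdeal hΓ S I) ∧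
    Nonempty
      ((GBP.PathAlgebra k (GBP.Glue S) ⧸ (GBP.glueIdeal Ω ⊔ GBP.inducedIdeal hΓ S I).asIdeal)
        ≃ₐ[k] GBP.GBPAlgebra Ω I) :=
  ⟨GBP.isAdmissible_glueIdeal_sup_inducedIdeal Ω hΓ hΩ I hIadm,
    ⟨GBP.glueQuotientEquivGBP hΓ Ω I⟩⟩
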